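/- Let $f_1,\dots,f_M:\mathbb R^n\to\mathbb R^n$ be locally Lipschitz vector fields with $f_i(0)=0$ such that every solution of $\dot x=f_i(x)$ exists for all times in $\mathbb R$, and let $\Phi_i:\mathbb R\times\mathbb R^n\to\mathbb R^n$ denote the corresponding flow. Let $\tau_2\ge\tau_1\ge 0$. A switching signal is a right-continuous, piecewise constant function $\sigma:[0,\infty)\to\{1,\dots,M\}$ (finitely many discontinuities in each bounded interval). Let $\mathcal S_{\mathrm{dw}}(\tau_1,\tau_2)$ be the set of switching signals with infinitely many discontinuities $0<t_1<t_2<\cdots$ such that, with $t_0=0$, $\tau_1\le t_{k+1}-t_k\le\tau_2$ for all $k\ge 0$. Let $\mathcal S^\star_{\mathrm{dw}}(\tau_1,\tau_2)$ be the set of those for which instead $t_1\le\tau_2$ and $\tau_1\le t_{k+1}-t_k\le\tau_2$ for all $k\ge 1$. The switched system $\dot x(t)=f_{\sigma(t)}(x(t))$ is called globally uniformly asymptotically stable (GUAS) on a class $\mathcal S$ of signals if there is $\beta\in\mathcal{KL}$ such that, for every $\sigma\in\mathcal S$, the solution $x$ from any $x(0)=x_0\in\mathbb R^n$ satisfies $|x(t)|\le\beta(|x_0|,t)$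 for all $t\ge 0$. Here $\alpha:[0,\infty)\to\mathbb R$ is of class $\mathcal K$ if it is continuous, strictly increasing and $\alpha(0)=0$, and of class $\mathcal K_\infty$ if moreover it is unbounded; a continuous $\beta:[0,\infty)^2\to[0,\infty)$ is of class $\mathcal{KL}$ if $\beta(\cdot,s)\in\mathcal K$ for every $s$ and, for every $r$, $\beta(r,\cdot)$ is non-increasing with limit $0$ at infinity. Then the following are equivalent: (a) the switched system is GUAS on $\mathcal S_{\mathrm{dw}}(\tau_1,\tau_2)$; (b) the switched system is GUAS on $\mathcal S^\star_{\mathrm{dw}}(\tau_1,\tau_2)$; (c) there exist $\alpha_1,\alpha_2\in\mathcal K_\infty$ and continuous functions $V_i^-,V_i^+:\mathbb R^n\to\mathbb R$, $i\in\{1,\dots,M\}$, such that $$\alpha_1(|x|)\le V_i^{*}(x)\le\alpha_2(|x|)\quad\text{for all } i,\ *\in\{-,+\},\ x\in\mathbb R^n,$$ $$V_i^+(\Phi_i(t,x))\le e^{-t}V_i^-(x)\quad\text{for all } i,\ t\in[0,\tau_2-\tau_1],\ x\in\mathbb R^n,$$ $$V_j^-(\Phi_i(\tau_1,x))\le e^{-\tau_1}V_i^+(x)\quad\text{for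 all } i\ne j,\ x\in\mathbb R^n.$$ -/

import Mathlib

open Set Filter Topology
open scoped NNReal

namespace SwitchedSystem

/-- Class `K`: continuous and strictly increasing on `[0, ∞)`, zero at zero
(only the values on `[0, ∞)` matter). -/
structure ClassK (α : ℝ → ℝ) : Prop where
  continuousOn : ContinuousOn α (Ici 0)
  map_zero : α 0 = 0
  strictMonoOn : StrictMonoOn α (Ici 0)

/-- Class `K∞`: class `K` and unbounded on `[0, ∞)`. -/
structure ClassKInfty (α : ℝ → ℝ) : Prop extends ClassK α where
  unbounded : ¬ BddAbove (α '' Ici 0)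

/-- Class `KL`: jointly continuous on `[0, ∞) × [0, ∞)`, of class `K` in the first variable,
decreasing (in the weak sense) to `0` in the second variable. -/
structure ClassKL (β : ℝ → ℝ → ℝ) : Prop where
  continuousOn : ContinuousOn (Function.uncurry β) (Ici 0 ×ˢ Ici 0)
  classK : ∀ s, 0 ≤ s → ClassK (fun r => β r s)
  antitoneOn : ∀ r, 0 ≤ r → AntitoneOn (β r) (Ici 0)
  tendsto_zero : ∀ r, 0 ≤ r → Tendsto (β r) atTop (𝓝 0)

variable {n M : ℕ}

/-- Standing assumption on each vector field: it vanishes at the origin, it is locally Lipschitz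
(so that solutions are unique), and from every initial point there is a solution of `x' = f x`
defined for all (positive and negative) times. -/
structure IsRegular (f : EuclideanSpace ℝ (Fin n) → EuclideanSpace ℝ (Fin n)) : Prop where
  map_zero : f 0 = 0
  locallyLipschitz : LocallyLipschitz f
  complete : ∀ x : EuclideanSpace ℝ (Fin n), ∃ φ : ℝ → EuclideanSpace ℝ (Fin n),
    φ 0 = x ∧ ∀ t : ℝ, HasDerivAt φ (f (φ t)) t

/-- The flow `Φ (t, x)`: the solution of `x' = f x` starting at `x`, evaluated at time `t`. -/
noncomputable def flow {f : EuclideanSpace ℝ (Fin n) → EuclideanSpace ℝ (Fin n)}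
    (hf : IsRegular f) (t : ℝ) (x : EuclideanSpace ℝ (Fin n)) : EuclideanSpace ℝ (Fin n) :=
  Classical.choose (hf.complete x) t

/-- The points of discontinuity of `σ : [0, ∞) → {1, …, M}`. -/
def discontinuities (σ : ℝ≥0 → Fin M) : Set ℝ≥0 :=
  {t | ¬ ContinuousAt σ t}

/-- Switching signals: right continuous and piecewise constant, i.e. with finitely many
discontinuities in every bounded interval. -/
def signals (M : ℕ) : Set (ℝ≥0 → Fin M) :=
  {σ | (∀ t, ContinuousWithinAt σ (Ici t) t) ∧ ∀ T, (discontinuities σ ∩ Iic T).Finite}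

/-- `t 0 = 0 < t 1 < t 2 < …` is the (infinite) sequence of switching instants of `σ`: apart from
the initial instant `0`, its values are exactly the discontinuities of `σ`. -/
structure IsSwitchingSequence (σ : ℝ≥0 → Fin M) (t : ℕ → ℝ≥0) : Prop where
  zero : t 0 = 0
  strictMono : StrictMono t
  range_eq : range t = insert 0 (discontinuities σ)

/-- Signals that keep switching and all of whose switching intervals have length in `[τ₁, τ₂]`. -/
def dwellSignals (M : ℕ) (τ₁ τ₂ : ℝ) : Set (ℝ≥0 → Fin M) :=
  {σ | σ ∈ signals M ∧ ∃ t : ℕ → ℝ≥0, IsSwitchingSequence σ t ∧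
    ∀ k, τ₁ ≤ (t (k + 1) : ℝ) - t k ∧ (t (k + 1) : ℝ) - t k ≤ τ₂}

/-- The same class without the lower bound on the first switching interval. -/
def dwellSignalsStar (M : ℕ) (τ₁ τ₂ : ℝ) : Set (ℝ≥0 → Fin M) :=
  {σ | σ ∈ signals M ∧ ∃ t : ℕ → ℝ≥0, IsSwitchingSequence σ t ∧ (t 1 : ℝ) ≤ τ₂ ∧
    ∀ k, 1 ≤ k → τ₁ ≤ (t (k + 1) : ℝ) - t k ∧ (t (k + 1) : ℝ) - t k ≤ τ₂}

/-- `x` solves `x' (t) = f_{σ (t)} (x (t))`, `x 0 = x₀` on `[0, ∞)`. It is continuous and satisfies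
the equation with the right derivative at every time; as `σ` is right continuous and piecewise
constant, this is the same as satisfying it with the two-sided derivative between any two
consecutive switching instants. -/
structure IsSolution (f : Fin M → EuclideanSpace ℝ (Fin n) → EuclideanSpace ℝ (Fin n))
    (σ : ℝ≥0 → Fin M) (x₀ : EuclideanSpace ℝ (Fin n)) (x : ℝ → EuclideanSpace ℝ (Fin n)) :
    Prop where
  initial : x 0 = x₀
  continuousOn : ContinuousOn x (Ici 0)
  hasDerivWithinAt : ∀ t : ℝ≥0, HasDerivWithinAt x (f (σ t) (x t)) (Ici (t : ℝ)) t

/-- Global uniform asymptotic stability of the switched system on a class `S` of signals. -/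
def GUAS (f : Fin M → EuclideanSpace ℝ (Fin n) → EuclideanSpace ℝ (Fin n))
    (S : Set (ℝ≥0 → Fin M)) : Prop :=
  ∃ β : ℝ → ℝ → ℝ, ClassKL β ∧ ∀ σ ∈ S, ∀ (x₀ : EuclideanSpace ℝ (Fin n))
    (x : ℝ → EuclideanSpace ℝ (Fin n)), IsSolution f σ x₀ x →
      ∀ t : ℝ, 0 ≤ t → ‖x t‖ ≤ β ‖x₀‖ t

/-- Existence of multiple Lyapunov functions `V_i⁻`, `V_i⁺`. -/
def HasLyapunovFunctions {f : Fin M → EuclideanSpace ℝ (Fin n) → EuclideanSpace ℝ (Fin n)}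
    (hf : ∀ i, IsRegular (f i)) (τ₁ τ₂ : ℝ) : Prop :=
  ∃ (α₁ α₂ : ℝ → ℝ) (Vminus Vplus : Fin M → EuclideanSpace ℝ (Fin n) → ℝ),
    ClassKInfty α₁ ∧ ClassKInfty α₂ ∧
    (∀ i, Continuous (Vminus i)) ∧ (∀ i, Continuous (Vplus i)) ∧
    (∀ i x, α₁ ‖x‖ ≤ Vminus i x ∧ Vminus i x ≤ α₂ ‖x‖) ∧
    (∀ i x, α₁ ‖x‖ ≤ Vplus i x ∧ Vplus i x ≤ α₂ ‖x‖) ∧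
    (∀ i, ∀ t ∈ Icc 0 (τ₂ - τ₁), ∀ x,
      Vplus i (flow (hf i) t x) ≤ Real.exp (-t) * Vminus i x) ∧
    (∀ i j, i ≠ j → ∀ x,
      Vminus j (flow (hf i) τ₁ x) ≤ Real.exp (-τ₁) * Vplus i x)

end SwitchedSystem

/-! (b)⇒(a) holds because the class in (a) is smaller. For (c)⇒(b), split a full switching interval
of length ℓ into ℓ - τ₁ followed by τ₁: the two inequalities multiply `V⁻` by at most e^{-ℓ} between
consecutive switching instants. The possibly short first interval and the unfinished last one are
absorbed by `exists_flow_bound`.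

For (a)⇒(c), Sontag's estimate `ClassKL.exists_exp_bound` gives α(β(r,t)) e^{2t} ≤ ρ(r). Let V_i⁻(x)
be the supremum of e^T α(|endpoint|) over finite runs of duration T that start in mode i. Prepending
a full interval of mode i yields the dynamic programming inequality `exp_mul_valueFunction_le`. Then
V_i⁺ is the maximum of α(|x|) and of e^{τ₁} V_j⁻(Φ_i(τ₁,x)) over j ≠ i, which builds in the
switching inequality. Only e^T of the available e^{2T} is spent, so long runs contribute little and
V⁻ is continuous (`continuous_valueFunction`).

Finite runs are not admissible signals: they stop, and may have zero durations when τ₁ = 0.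
`norm_endpoint_le_of_dwell` extends and perturbs them, then passes to the limit. -/

namespace SwitchedSystem

/-! ### Comparison functions. -/

open MeasureTheory in
/-- The average over `[s, 2s]` of a monotone function. -/
theorem monotone_average {g : ℝ → ℝ} (hg : Monotone g) :
    ContinuousOn (fun s => ∫ u in (1:ℝ)..2, g (s * u)) (Ioi 0) ∧
    MonotoneOn (fun s => ∫ u in (1:ℝ)..2, g (s * u)) (Ici 0) ∧
    ∀ s, 0 ≤ s → g s ≤ ∫ u in (1:ℝ)..2, g (s * u) ∧ ∫ u in (1:ℝ)..2, g (s * u) ≤ g (2 * s) := by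
  have hint : ∀ s, 0 ≤ s → IntervalIntegrable (fun u => g (s * u)) volume 1 2 := by
    intro s hs
    apply MonotoneOn.intervalIntegrable
    intro a _ b _ hab
    exact hg (by gcongr)
  refine ⟨?_, ?_, ?_⟩
  · have hP : Continuous fun b => ∫ u in (0:ℝ)..b, g u :=
      intervalIntegral.continuous_primitive (fun a b => hg.intervalIntegrable) 0
    -- Rescaling turns the average into a difference quotient of the continuous primitive of `g`.
    have h : ∀ s ∈ Ioi (0:ℝ), (∫ u in (1:ℝ)..2, g (s * u)) =
        s⁻¹ * ((∫ u in (0:ℝ)..(s * 2), g u) - ∫ u in (0:ℝ)..s, g u) := by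
      intro s hs
      have hs' : s ≠ 0 := ne_of_gt hs
      rw [intervalIntegral.integral_comp_mul_left _ hs',
        intervalIntegral.integral_interval_sub_left hg.intervalIntegrable hg.intervalIntegrable]
      simp
    refine ContinuousOn.congr ?_ h
    refine ContinuousOn.mul (continuousOn_inv₀.mono fun s hs => ne_of_gt hs) ?_
    exact Continuous.continuousOn ((hP.comp (by fun_prop)).sub hP)
  · intro a ha b hb hab
    apply intervalIntegral.integral_mono_on (by norm_num) (hint a ha) (hint b hb)
    intro u hu
    apply hg
    have := hu.1
    gcongr
  · intro s hs
    constructor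
    · calc g s = ∫ u in (1:ℝ)..2, g s := by rw [intervalIntegral.integral_const]; norm_num
        _ ≤ _ := by
          apply intervalIntegral.integral_mono_on (by norm_num) (by simp) (hint s hs)
          intro u hu
          exact hg (by nlinarith [hu.1])
    · calc _ ≤ ∫ u in (1:ℝ)..2, g (2 * s) := by
            apply intervalIntegral.integral_mono_on (by norm_num) (hint s hs) (by simp)
            intro u hu
            exact hg (by nlinarith [hu.2])
        _ = g (2 * s) := by rw [intervalIntegral.integral_const]; norm_num

theorem ClassK.nonneg {α : ℝ → ℝ} (h : ClassK α) {s : ℝ} (hs : 0 ≤ s) : 0 ≤ α s := by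
  rw [← h.map_zero]
  exact h.strictMonoOn.monotoneOn (self_mem_Ici) hs hs

theorem ClassK.mono {α : ℝ → ℝ} (h : ClassK α) {s t : ℝ} (hs : 0 ≤ s) (hst : s ≤ t) :
    α s ≤ α t :=
  h.strictMonoOn.monotoneOn hs (hs.trans hst : (0:ℝ) ≤ t) hst

theorem ClassK.pos {α : ℝ → ℝ} (h : ClassK α) {s : ℝ} (hs : 0 < s) : 0 < α s := by
  rw [← h.map_zero]
  exact h.strictMonoOn self_mem_Ici hs.le hs

theorem ClassK.comp {α γ : ℝ → ℝ} (h : ClassK α) (h' : ClassK γ) :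
    ClassK (fun s => α (γ s)) where
  continuousOn := h.continuousOn.comp h'.continuousOn fun _ hs => h'.nonneg hs
  map_zero := by rw [h'.map_zero, h.map_zero]
  strictMonoOn := fun a ha b hb hab =>
    h.strictMonoOn (h'.nonneg ha) (h'.nonneg hb) (h'.strictMonoOn ha hb hab)

theorem ClassK.const_mul {α : ℝ → ℝ} (h : ClassK α) {c : ℝ} (hc : 0 < c) :
    ClassK (fun s => c * α s) where
  continuousOn := h.continuousOn.const_mul c
  map_zero := by rw [h.map_zero, mul_zero]
  strictMonoOn := fun _ ha _ hb hab => mul_lt_mul_of_pos_left (h.strictMonoOn ha hb hab) hc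

/-- A relation that is locally bounded and small near zero has a `K∞` upper bound. -/
theorem exists_classKInfty_majorant (P : ℝ → ℝ → Prop)
    (hbdd : ∀ R, 0 ≤ R → ∃ C, ∀ r, 0 ≤ r → r ≤ R → ∀ v, P r v → v ≤ C)
    (hsmall : ∀ ε, 0 < ε → ∃ δ > 0, ∀ r, 0 ≤ r → r ≤ δ → ∀ v, P r v → v ≤ ε) :
    ∃ ρ : ℝ → ℝ, ClassKInfty ρ ∧ (∀ r, 0 ≤ r → r ≤ ρ r) ∧
      ∀ r, 0 ≤ r → ∀ v, P r v → v ≤ ρ r := by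
  -- The inserted 0 keeps the set nonempty and its supremum nonnegative, also for negative `r`.
  set S : ℝ → Set ℝ := fun r => insert 0 {v | ∃ r', 0 ≤ r' ∧ r' ≤ r ∧ P r' v} with hS
  have hSb : ∀ r, BddAbove (S r) := by
    intro r
    apply BddAbove.insert
    obtain ⟨C, hC⟩ := hbdd (max r 0) (le_max_right _ _)
    exact ⟨C, fun v ⟨r', h0, h1, h2⟩ => hC r' h0 (h1.trans (le_max_left _ _)) v h2⟩
  have hSn : ∀ r, (S r).Nonempty := fun r => ⟨0, mem_insert _ _⟩
  set g : ℝ → ℝ := fun r => sSup (S r) with hgdef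
  have hg : Monotone g := by
    intro a b hab
    apply csSup_le_csSup (hSb b) (hSn a)
    apply insert_subset_insert
    rintro v ⟨r', h0, h1, h2⟩
    exact ⟨r', h0, h1.trans hab, h2⟩
  have hg0 : ∀ r, 0 ≤ g r := fun r => le_csSup (hSb r) (mem_insert _ _)
  have hgs : ∀ ε, 0 < ε → ∃ δ > 0, g δ ≤ ε := by
    intro ε hε
    obtain ⟨δ, hδ, h⟩ := hsmall ε hε
    refine ⟨δ, hδ, csSup_le (hSn _) ?_⟩
    rintro v (rfl | ⟨r', h0, h1, h2⟩)
    · exact hε.le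
    · exact h r' h0 h1 v h2
  obtain ⟨hc, hm, hb⟩ := monotone_average hg
  set A : ℝ → ℝ := fun s => ∫ u in (1:ℝ)..2, g (s * u) with hA
  have hA0 : A 0 = 0 := by
    have h1 := (hb 0 le_rfl).2
    have h2 := (hb 0 le_rfl).1
    apply le_antisymm _ ((hg0 0).trans h2)
    apply le_of_forall_pos_le_add
    intro ε hε
    obtain ⟨δ, hδ, h⟩ := hgs ε hε
    have : g (2 * 0) ≤ g δ := hg (by linarith)
    linarith
  -- The summand `s` supplies strict growth, unboundedness and the bound `r ≤ ρ r`.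
  refine ⟨fun s => A s + s, ⟨⟨?_, ?_, ?_⟩, ?_⟩, ?_, ?_⟩
  · apply ContinuousOn.add _ continuousOn_id
    intro s hs
    rcases eq_or_lt_of_le (mem_Ici.1 hs) with rfl | hs'
    · rw [Metric.continuousWithinAt_iff]
      intro ε hε
      obtain ⟨δ, hδ, h⟩ := hgs (ε / 2) (by linarith)
      refine ⟨δ / 2, by linarith, fun {x} hx hxd => ?_⟩
      rw [hA0, Real.dist_0_eq_abs] at *
      have hx0 : (0:ℝ) ≤ x := hx
      rw [abs_of_nonneg hx0] at hxd
      have h1 := hb x hx0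
      have h2 : g (2 * x) ≤ g δ := hg (by linarith)
      have h3 : 0 ≤ A x := (hg0 x).trans h1.1
      rw [abs_of_nonneg h3]
      simp only [hA]
      linarith
    · exact (hc.continuousAt (Ioi_mem_nhds hs')).continuousWithinAt
  · simp [hA0]
  · intro a ha b hb hab
    exact add_lt_add_of_le_of_lt (hm ha hb hab.le) hab
  · rintro ⟨C, hC⟩
    have h1 := hC ⟨max C 0 + 1, by simp only [mem_Ici]; positivity, rfl⟩
    have h0 : (0:ℝ) ≤ max C 0 + 1 := by positivity
    have h2 := (hg0 _).trans (hb _ h0).1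
    have h3 := le_max_left C 0
    simp only [hA] at h1
    linarith
  · intro r hr
    have := (hg0 _).trans (hb r hr).1
    simp only [hA]
    linarith
  · intro r hr v hv
    have h1 : v ≤ g r := le_csSup (hSb r) (mem_insert_of_mem _ ⟨r, hr, le_rfl, hv⟩)
    have := (hb r hr).1
    simp only [hA]
    linarith

theorem ClassKInfty.exists_gt {α : ℝ → ℝ} (h : ClassKInfty α) (C : ℝ) :
    ∃ s, 0 ≤ s ∧ C < α s := by
  by_contra! hc
  exact h.unbounded ⟨C, by rintro _ ⟨s, hs, rfl⟩; exact hc s hs⟩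

/-- Stands in for α⁻¹: unboundedness of `α` bounds the sublevel sets, and strict growth shrinks them
to 0. -/
theorem ClassKInfty.exists_inverse_bound {α : ℝ → ℝ} (h : ClassKInfty α) :
    ∃ ψ : ℝ → ℝ, ClassKInfty ψ ∧ ∀ r v, 0 ≤ r → 0 ≤ v → α v ≤ r → v ≤ ψ r := by
  suffices H : _ ∧ _ by
    obtain ⟨ψ, h1, -, h2⟩ := exists_classKInfty_majorant (fun r v => 0 ≤ v ∧ α v ≤ r) H.1 H.2
    exact ⟨ψ, h1, fun r v hr hv hle => h2 r hr v ⟨hv, hle⟩⟩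
  constructor
  · intro R hR
    obtain ⟨s, hs, hsR⟩ := h.exists_gt R
    refine ⟨s, fun r _ hr v ⟨hv, hvr⟩ => ?_⟩
    by_contra! hlt
    have := h.mono hs hlt.le
    linarith
  · intro ε hε
    refine ⟨α ε, h.pos hε, fun r _ hr v ⟨hv, hvr⟩ => ?_⟩
    by_contra! hlt
    have := h.strictMonoOn hε.le hv hlt
    linarith

theorem ClassKL.nonneg {β : ℝ → ℝ → ℝ} (h : ClassKL β) {r s : ℝ} (hr : 0 ≤ r) (hs : 0 ≤ s) :
    0 ≤ β r s := (h.classK s hs).nonneg hr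

/-- Sontag's estimate: up to a `K∞` change of coordinates, a `KL` function decays exponentially. -/
theorem ClassKL.exists_exp_bound {β : ℝ → ℝ → ℝ} (h : ClassKL β) :
    ∃ α ρ : ℝ → ℝ, ClassKInfty α ∧ ClassKInfty ρ ∧
      ∀ r t, 0 ≤ r → 0 ≤ t → α (β r t) * Real.exp (2 * t) ≤ ρ r := by
  -- Tying the radius 1/s to the level s leaves one parameter: past `sInf (S s)`, trajectories from
  -- radius 1/s have bound below s.
  set S : ℝ → Set ℝ := fun s => {t | 0 ≤ t ∧ β s⁻¹ t < s} with hS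
  have hSb : ∀ s, BddBelow (S s) := fun s => ⟨0, fun t ht => ht.1⟩
  have hSn : ∀ s, 0 < s → (S s).Nonempty := by
    intro s hs
    obtain ⟨t, ht, ht'⟩ := (((h.tendsto_zero s⁻¹ (by positivity)).eventually
      (gt_mem_nhds hs)).and (eventually_ge_atTop 0)).exists
    exact ⟨t, ht', ht⟩
  have hT0 : ∀ s, 0 ≤ sInf (S s) := fun s => Real.sInf_nonneg fun t ht => ht.1
  set q : ℝ → ℝ := fun s => if 0 < s then Real.exp (-(2 * sInf (S s))) else 0 with hq
  have hq0 : ∀ s, 0 ≤ q s := by intro s; simp only [hq]; split_ifs <;> positivity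
  have hqpos : ∀ s, 0 < s → 0 < q s := by intro s hs; simp only [hq, if_pos hs]; positivity
  have hq1 : ∀ s, q s ≤ 1 := by
    intro s
    simp only [hq]
    split_ifs
    · rw [Real.exp_le_one_iff]; linarith [hT0 s]
    · norm_num
  have hqm : Monotone q := by
    intro a b hab
    by_cases ha : 0 < a
    · have hb : 0 < b := ha.trans_le hab
      simp only [hq, if_pos ha, if_pos hb]
      have : sInf (S b) ≤ sInf (S a) := by
        apply csInf_le_csInf (hSb b) (hSn a ha)
        rintro t ⟨ht0, ht⟩
        refine ⟨ht0, ?_⟩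
        have := (h.classK t ht0).mono (s := b⁻¹) (t := a⁻¹) (by positivity) (by gcongr)
        linarith
      gcongr
    · have : q a = 0 := if_neg ha
      rw [this]
      exact hq0 b
  -- With v = β(r,t) and r ≤ 1/v, β(1/v,·) is still at least v at time t, so the threshold time of v
  -- is at least t.
  have hkey : ∀ r t, 0 ≤ r → 0 ≤ t → 0 < β r t → r * β r t ≤ 1 →
      q (β r t) * Real.exp (2 * t) ≤ 1 := by
    intro r t hr ht hpos hle
    have hle' : r ≤ (β r t)⁻¹ := by
      rw [← one_div, le_div_iff₀ hpos]; exact hle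
    have h1 : t ≤ sInf (S (β r t)) := by
      apply le_csInf (hSn _ hpos)
      rintro t' ⟨ht', hlt⟩
      by_contra! hcon
      have h2 := h.antitoneOn (β r t)⁻¹ (by positivity) ht' ht hcon.le
      have h3 := (h.classK t ht).mono hr hle'
      linarith
    simp only [hq, if_pos hpos]
    rw [← Real.exp_add, Real.exp_le_one_iff]
    linarith
  obtain ⟨hc, hm, hb⟩ := monotone_average hqm
  set A : ℝ → ℝ := fun s => ∫ u in (1:ℝ)..2, q (s * u) with hA
  have hA0 : ∀ s, 0 ≤ s → 0 ≤ A s := fun s hs => (hq0 s).trans (hb s hs).1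
  have hA1 : ∀ s, 0 ≤ s → A s ≤ 1 := fun s hs => (hb s hs).2.trans (hq1 _)
  -- Halving the argument gives `A (s / 2) ≤ q s`; the factor `s` gives continuity at 0, strict
  -- growth and unboundedness.
  set α : ℝ → ℝ := fun s => s * A (s / 2) with hα
  have hαle : ∀ s, 0 ≤ s → α s ≤ s * q s := by
    intro s hs
    have := (hb (s / 2) (by linarith)).2
    rw [show 2 * (s / 2) = s by ring] at this
    exact mul_le_mul_of_nonneg_left this hs
  have hαK : ClassKInfty α := by
    refine ⟨⟨?_, by simp [hα], ?_⟩, ?_⟩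
    · intro s hs
      rcases eq_or_lt_of_le (mem_Ici.1 hs) with rfl | hs'
      · have h0 : α 0 = 0 := by simp [hα]
        rw [ContinuousWithinAt, h0]
        refine tendsto_of_tendsto_of_tendsto_of_le_of_le' tendsto_const_nhds
          (tendsto_nhdsWithin_of_tendsto_nhds tendsto_id) ?_ ?_
        · filter_upwards [self_mem_nhdsWithin] with x hx
          have hx0 : (0:ℝ) ≤ x := hx
          exact mul_nonneg hx0 (hA0 _ (by linarith))
        · filter_upwards [self_mem_nhdsWithin] with x hx
          have hx0 : (0:ℝ) ≤ x := hx
          exact (mul_le_of_le_one_right hx0 (hA1 _ (by linarith)))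
      · apply ContinuousAt.continuousWithinAt
        apply continuousAt_id.mul
        have hAs : ContinuousAt A (s / 2) := hc.continuousAt (Ioi_mem_nhds (by positivity))
        exact ContinuousAt.comp (g := A) (f := fun s : ℝ => s / 2) hAs (by fun_prop)
    · intro a ha b hb' hab
      have ha0 : (0:ℝ) ≤ a := ha
      have hb0 : (0:ℝ) < b := ha0.trans_lt hab
      have h1 : A (a / 2) ≤ A (b / 2) := hm (by simp only [mem_Ici]; linarith)
        (by simp only [mem_Ici]; linarith) (by linarith)
      have h2 : 0 < A (b / 2) := (hqpos _ (by linarith)).trans_le (hb (b / 2) (by linarith)).1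
      simp only [hα]
      calc a * A (a / 2) ≤ a * A (b / 2) := by gcongr
        _ < b * A (b / 2) := by gcongr
    · rintro ⟨C, hC⟩
      have h2 : 0 < A 1 := (hqpos _ one_pos).trans_le (hb 1 zero_le_one).1
      set s := 2 + |C| / A 1 with hs
      have hs2 : 2 ≤ s := by rw [hs]; linarith [show 0 ≤ |C| / A 1 by positivity]
      have h3 := hC ⟨s, by simp only [mem_Ici]; linarith, rfl⟩
      have h4 : A 1 ≤ A (s / 2) := hm (by simp) (by simp only [mem_Ici]; linarith) (by linarith)
      have h5 : s * A 1 ≤ s * A (s / 2) := by gcongr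
      have h6 : s * A 1 = 2 * A 1 + |C| := by rw [hs]; field_simp
      have h7 := le_abs_self C
      simp only [hα] at h3
      linarith
  have hlocal : ∀ r t, 0 ≤ r → 0 ≤ t → r * β r t ≤ 1 →
      α (β r t) * Real.exp (2 * t) ≤ β r t := by
    intro r t hr ht hle
    have hn := h.nonneg hr ht
    rcases eq_or_lt_of_le hn with h0 | hpos
    · rw [← h0]; simp [hα]
    · calc α (β r t) * Real.exp (2 * t) ≤ (β r t * q (β r t)) * Real.exp (2 * t) := by
            gcongr; exact hαle _ hn
        _ = β r t * (q (β r t) * Real.exp (2 * t)) := by ring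
        _ ≤ β r t * 1 := by gcongr; exact hkey r t hr ht hpos hle
        _ = β r t := mul_one _
  suffices H : _ ∧ _ by
    obtain ⟨ρ, hρ, -, hle⟩ := exists_classKInfty_majorant
      (fun r v => ∃ t, 0 ≤ t ∧ v = α (β r t) * Real.exp (2 * t)) H.1 H.2
    exact ⟨α, ρ, hαK, hρ, fun r t hr ht => hle r hr _ ⟨t, ht, rfl⟩⟩
  constructor
  · intro R hR
    -- Past a time `T` with β(R',T) < 1/R' the condition of `hlocal` holds; before `T` the
    -- exponential is at most e^{2T}.
    set R' := R + 1
    have hR' : 0 < R' := by positivity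
    obtain ⟨T, hT, hT0⟩ := (((h.tendsto_zero R' hR'.le).eventually
      (gt_mem_nhds (inv_pos.2 hR'))).and (eventually_ge_atTop 0)).exists
    refine ⟨β R' 0 * Real.exp (2 * T), ?_⟩
    rintro r hr hrR v ⟨t, ht, rfl⟩
    have hb1 : β r t ≤ β R' t := (h.classK t ht).mono hr (by linarith)
    have hb2 : β R' t ≤ β R' 0 := h.antitoneOn R' hR'.le self_mem_Ici ht ht
    have hb3 := h.nonneg hr ht
    rcases le_total T t with hTt | htT
    · have hb4 : β R' t ≤ β R' T := h.antitoneOn R' hR'.le hT0 ht hTt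
      have h1 : r * β r t ≤ 1 := by
        calc r * β r t ≤ R' * R'⁻¹ := by
              apply mul_le_mul (by linarith) (by linarith) hb3 hR'.le
          _ = 1 := mul_inv_cancel₀ hR'.ne'
      have h2 := hlocal r t hr ht h1
      have h3 : (1:ℝ) ≤ Real.exp (2 * T) := Real.one_le_exp (by linarith)
      have h4 : 0 ≤ β R' 0 := by linarith
      nlinarith
    · have h1 : α (β r t) ≤ β R' 0 := by
        have h2 := hαle (β r t) hb3
        have h3 := mul_le_of_le_one_right hb3 (hq1 (β r t))
        linarith
      have h4 : 0 ≤ β R' 0 := by linarith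
      apply mul_le_mul h1 _ (by positivity) h4
      gcongr
  · intro ε hε
    have hK := h.classK 0 le_rfl
    have hcont : Tendsto (fun r => β r 0) (𝓝[Ici 0] 0) (𝓝 0) := by
      have := hK.continuousOn 0 self_mem_Ici
      rwa [ContinuousWithinAt, hK.map_zero] at this
    obtain ⟨δ, hδ, hδ'⟩ := Metric.mem_nhdsWithin_iff.1
      (hcont.eventually (gt_mem_nhds (lt_min one_pos hε)))
    -- Here r ≤ 1 and β(r,0) < 1, so `hlocal` applies at every time.
    refine ⟨min (δ / 2) 1, by positivity, ?_⟩
    rintro r hr hrd v ⟨t, ht, rfl⟩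
    have hr1 : r ≤ δ / 2 := hrd.trans (min_le_left _ _)
    have hr2 : r ≤ 1 := hrd.trans (min_le_right _ _)
    have h1 : β r 0 < min 1 ε := hδ' ⟨by
      rw [Metric.mem_ball, Real.dist_0_eq_abs, abs_of_nonneg hr]; linarith, hr⟩
    have h2 : β r t ≤ β r 0 := h.antitoneOn r hr self_mem_Ici ht ht
    have h3 := h.nonneg hr ht
    have h4 := lt_min_iff.1 h1
    have h5 := hlocal r t hr ht (by nlinarith)
    linarith

/-! ### Uniqueness, continuity and growth of the flows. -/

section Flow

variable {n M : ℕ} {f : EuclideanSpace ℝ (Fin n) → EuclideanSpace ℝ (Fin n)}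

theorem flow_zero (hf : IsRegular f) (x : EuclideanSpace ℝ (Fin n)) : flow hf 0 x = x :=
  (Classical.choose_spec (hf.complete x)).1

theorem hasDerivAt_flow (hf : IsRegular f) (t : ℝ) (x : EuclideanSpace ℝ (Fin n)) :
    HasDerivAt (fun t => flow hf t x) (f (flow hf t x)) t :=
  (Classical.choose_spec (hf.complete x)).2 t

theorem continuous_flow_time (hf : IsRegular f) (x : EuclideanSpace ℝ (Fin n)) :
    Continuous fun t => flow hf t x :=
  continuous_iff_continuousAt.2 fun t => (hasDerivAt_flow hf t x).continuousAt

theorem IsRegular.exists_lipschitzOnWith (hf : IsRegular f) (R : ℝ) :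
    ∃ K, LipschitzOnWith K f (Metric.closedBall 0 R) :=
  (hf.locallyLipschitz.locallyLipschitzOn (s := Metric.closedBall 0 R)).exists_lipschitzOnWith_of_compact
    (isCompact_closedBall 0 R)

/-- On a compact interval both curves stay in one ball, where `f` is Lipschitz; Grönwall with
initial distance 0 finishes. Right derivatives suffice, which is what switched solutions offer. -/
theorem eq_flow_of_hasDerivWithinAt (hf : IsRegular f) {x : ℝ → EuclideanSpace ℝ (Fin n)}
    {a b : ℝ} (hx : ContinuousOn x (Icc a b))
    (hx' : ∀ t ∈ Ico a b, HasDerivWithinAt x (f (x t)) (Ici t) t) :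
    ∀ t ∈ Icc a b, x t = flow hf (t - a) (x a) := by
  set y : ℝ → EuclideanSpace ℝ (Fin n) := fun t => flow hf (t - a) (x a) with hy
  have hyc : Continuous y := (continuous_flow_time hf (x a)).comp (by fun_prop)
  have hyd : ∀ t, HasDerivAt y (f (y t)) t := fun t =>
    (hasDerivAt_flow hf (t - a) (x a)).comp_sub_const t a
  obtain ⟨R₁, h₁⟩ := (isCompact_Icc.image_of_continuousOn hx).isBounded.subset_closedBall 0
  obtain ⟨R₂, h₂⟩ := (isCompact_Icc.image_of_continuousOn
    (hyc.continuousOn (s := Icc a b))).isBounded.subset_closedBall 0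
  obtain ⟨K, hK⟩ := hf.exists_lipschitzOnWith (max R₁ R₂)
  intro t ht
  have := dist_le_of_trajectories_ODE_of_mem (v := fun _ => f)
    (s := fun _ => Metric.closedBall 0 (max R₁ R₂)) (δ := 0) (fun _ _ => hK) hx hx'
    (fun t ht => Metric.closedBall_subset_closedBall (le_max_left _ _)
      (h₁ (mem_image_of_mem x (Ico_subset_Icc_self ht))))
    hyc.continuousOn (fun t _ => (hyd t).hasDerivWithinAt)
    (fun t ht => Metric.closedBall_subset_closedBall (le_max_right _ _)
      (h₂ (mem_image_of_mem y (Ico_subset_Icc_self ht))))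
    (by simp [hy, flow_zero]) t ht
  rw [zero_mul] at this
  exact dist_le_zero.1 this

theorem flow_map_zero (hf : IsRegular f) {t : ℝ} (ht : 0 ≤ t) : flow hf t 0 = 0 := by
  have := eq_flow_of_hasDerivWithinAt hf (x := fun _ => 0) (a := 0) (b := t) continuousOn_const
    (fun s _ => by rw [hf.map_zero]; exact hasDerivWithinAt_const _ _ _) t ⟨ht, le_rfl⟩
  simpa using this.symm

/-- `flow` chooses a solution separately for each point, so this rests on uniqueness. -/
theorem flow_add (hf : IsRegular f) {s t : ℝ} (ht : 0 ≤ t) (x : EuclideanSpace ℝ (Fin n)) :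
    flow hf t (flow hf s x) = flow hf (s + t) x := by
  have := eq_flow_of_hasDerivWithinAt hf (x := fun u => flow hf (s + u) x) (a := 0) (b := t)
    ((continuous_flow_time hf x).comp (by fun_prop)).continuousOn
    (fun u _ => ((hasDerivAt_flow hf (s + u) x).comp_const_add s u).hasDerivWithinAt) t ⟨ht, le_rfl⟩
  simpa using this.symm

theorem dist_flow_le_of_mem_closedBall (hf : IsRegular f) {K : ℝ≥0} {R T : ℝ}
    (hK : LipschitzOnWith K f (Metric.closedBall 0 R)) (hT : 0 ≤ T)
    {x y : EuclideanSpace ℝ (Fin n)} (hx : ∀ t ∈ Ico 0 T, ‖flow hf t x‖ ≤ R)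
    (hy : ∀ t ∈ Ico 0 T, ‖flow hf t y‖ ≤ R) :
    dist (flow hf T x) (flow hf T y) ≤ dist x y * Real.exp (K * T) := by
  have := dist_le_of_trajectories_ODE_of_mem (v := fun _ => f)
    (s := fun _ => Metric.closedBall 0 R) (δ := dist x y) (a := 0) (b := T) (fun _ _ => hK)
    (continuous_flow_time hf x).continuousOn
    (fun t _ => (hasDerivAt_flow hf t x).hasDerivWithinAt)
    (fun t ht => mem_closedBall_zero_iff.2 (hx t ht))
    (continuous_flow_time hf y).continuousOn
    (fun t _ => (hasDerivAt_flow hf t y).hasDerivWithinAt)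
    (fun t ht => mem_closedBall_zero_iff.2 (hy t ht))
    (by simp [flow_zero]) T ⟨hT, le_rfl⟩
  simpa using this

/-- Continuation argument: take the Lipschitz constant on a unit neighbourhood of the reference
orbit. At a first time of distance at least 1, Grönwall would force the distance below 1 when |x -
x₀| < e^{-KT}. -/
theorem exists_dist_flow_le (hf : IsRegular f) (x₀ : EuclideanSpace ℝ (Fin n)) (T : ℝ) :
    ∃ C : ℝ, ∀ᶠ x in 𝓝 x₀, ∀ t ∈ Icc 0 T,
      dist (flow hf t x) (flow hf t x₀) ≤ C * dist x x₀ := by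
  obtain ⟨R, hR⟩ := (isCompact_Icc.image_of_continuousOn
    ((continuous_flow_time hf x₀).continuousOn (s := Icc 0 T))).isBounded.subset_closedBall 0
  have hR' : ∀ t ∈ Icc 0 T, ‖flow hf t x₀‖ ≤ R := fun t ht =>
    mem_closedBall_zero_iff.1 (hR (mem_image_of_mem _ ht))
  obtain ⟨K, hK⟩ := hf.exists_lipschitzOnWith (R + 1)
  refine ⟨Real.exp (K * T), ?_⟩
  filter_upwards [Metric.ball_mem_nhds x₀ (Real.exp_pos (-(K * T)))] with x hx
  have hgron : ∀ t ∈ Icc 0 T, (∀ s ∈ Ico 0 t, dist (flow hf s x) (flow hf s x₀) ≤ 1) →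
      dist (flow hf t x) (flow hf t x₀) ≤ Real.exp (K * T) * dist x x₀ := by
    intro t ht hs
    calc _ ≤ dist x x₀ * Real.exp (K * t) := by
          refine dist_flow_le_of_mem_closedBall hf hK ht.1 (fun s hst => ?_) fun s hst => ?_
          · have h1 := hs s hst
            have h2 := hR' s ⟨hst.1, hst.2.le.trans ht.2⟩
            have h3 := norm_le_norm_add_norm_sub' (flow hf s x) (flow hf s x₀)
            rw [dist_eq_norm] at h1
            linarith
          · have h2 := hR' s ⟨hst.1, hst.2.le.trans ht.2⟩
            linarith
      _ ≤ dist x x₀ * Real.exp (K * T) := by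
          have := ht.2
          gcongr
      _ = _ := mul_comm _ _
  have hlt : ∀ t ∈ Icc 0 T, dist (flow hf t x) (flow hf t x₀) < 1 := by
    by_contra! hcon
    set S := {t | t ∈ Icc 0 T ∧ 1 ≤ dist (flow hf t x) (flow hf t x₀)} with hS
    have hSc : IsCompact S := by
      have : IsClosed {t | 1 ≤ dist (flow hf t x) (flow hf t x₀)} :=
        isClosed_le continuous_const
          ((continuous_flow_time hf x).dist (continuous_flow_time hf x₀))
      exact isCompact_Icc.inter_right this
    obtain ⟨t, ht, hmin⟩ := hSc.exists_isLeast hcon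
    have h1 := hgron t ht.1 fun s hs => by
      by_contra! hc
      exact absurd (hmin ⟨⟨hs.1, hs.2.le.trans ht.1.2⟩, hc.le⟩) (not_le.2 hs.2)
    have h2 : Real.exp (K * T) * dist x x₀ < Real.exp (K * T) * Real.exp (-(K * T)) := by
      gcongr
      exact hx
    rw [← Real.exp_add, add_neg_cancel, Real.exp_zero] at h2
    linarith [ht.2]
  exact fun t ht => hgron t ht fun s hs => (hlt s ⟨hs.1, hs.2.le.trans ht.2⟩).le

theorem continuousOn_flow (hf : IsRegular f) :
    ContinuousOn (fun p : ℝ × EuclideanSpace ℝ (Fin n) => flow hf p.1 p.2) {p | 0 ≤ p.1} := by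
  rintro ⟨t₀, x₀⟩ -
  obtain ⟨C, hC⟩ := exists_dist_flow_le hf x₀ (t₀ + 1)
  rw [ContinuousWithinAt, tendsto_iff_dist_tendsto_zero]
  have hlim : Tendsto (fun p : ℝ × EuclideanSpace ℝ (Fin n) =>
      C * dist p.2 x₀ + dist (flow hf p.1 x₀) (flow hf t₀ x₀))
      (𝓝[{p | 0 ≤ p.1}] (t₀, x₀)) (𝓝 0) := by
    have hc : Continuous (fun p : ℝ × EuclideanSpace ℝ (Fin n) =>
        C * dist p.2 x₀ + dist (flow hf p.1 x₀) (flow hf t₀ x₀)) := by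
      have := (continuous_flow_time hf x₀).comp
        (continuous_fst (X := ℝ) (Y := EuclideanSpace ℝ (Fin n)))
      exact (continuous_const.mul (continuous_snd.dist continuous_const)).add
        (this.dist continuous_const)
    have := hc.tendsto (t₀, x₀)
    simp only [dist_self, mul_zero, add_zero] at this
    exact this.mono_left nhdsWithin_le_nhds
  refine squeeze_zero' (Eventually.of_forall fun _ => dist_nonneg) ?_ hlim
  have h1 : ∀ᶠ p in 𝓝[{p : ℝ × EuclideanSpace ℝ (Fin n) | 0 ≤ p.1}] (t₀, x₀), 0 ≤ p.1 :=
    self_mem_nhdsWithin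
  have h2 : ∀ᶠ p in 𝓝[{p : ℝ × EuclideanSpace ℝ (Fin n) | 0 ≤ p.1}] (t₀, x₀), p.1 < t₀ + 1 :=
    nhdsWithin_le_nhds (continuous_fst.continuousAt.eventually (gt_mem_nhds (lt_add_one t₀)))
  have h3 : ∀ᶠ p in 𝓝[{p : ℝ × EuclideanSpace ℝ (Fin n) | 0 ≤ p.1}] (t₀, x₀),
      ∀ t ∈ Icc 0 (t₀ + 1), dist (flow hf t p.2) (flow hf t x₀) ≤ C * dist p.2 x₀ :=
    nhdsWithin_le_nhds ((continuous_snd.tendsto (t₀, x₀)).eventually hC)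
  filter_upwards [h1, h2, h3] with p hp1 hp2 hp3
  exact (dist_triangle _ (flow hf p.1 x₀) _).trans
    (add_le_add_left (hp3 p.1 ⟨hp1, hp2.le⟩) _)

theorem continuous_flow (hf : IsRegular f) {t : ℝ} (ht : 0 ≤ t) : Continuous (flow hf t) :=
  (continuousOn_flow hf).comp_continuous (f := fun x => (t, x)) (by fun_prop) fun _ => ht

/-- Boundedness is compactness; smallness near 0 is `exists_dist_flow_le` at the equilibrium. -/
theorem exists_flow_bound {f : Fin M → EuclideanSpace ℝ (Fin n) → EuclideanSpace ℝ (Fin n)}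
    (hf : ∀ i, IsRegular (f i)) (T : ℝ) :
    ∃ χ : ℝ → ℝ, ClassKInfty χ ∧ (∀ r, 0 ≤ r → r ≤ χ r) ∧
      ∀ i, ∀ t ∈ Icc 0 T, ∀ x, ‖flow (hf i) t x‖ ≤ χ ‖x‖ := by
  suffices H : _ ∧ _ by
    obtain ⟨χ, h1, h2, h3⟩ := exists_classKInfty_majorant
      (fun r v => ∃ i, ∃ t ∈ Icc 0 T, ∃ x, ‖x‖ = r ∧ v = ‖flow (hf i) t x‖) H.1 H.2
    exact ⟨χ, h1, h2, fun i t ht x => h3 _ (norm_nonneg x) _ ⟨i, t, ht, x, rfl, rfl⟩⟩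
  constructor
  · intro R _
    have : ∀ i, ∃ C, ∀ t ∈ Icc 0 T, ∀ x, ‖x‖ ≤ R → ‖flow (hf i) t x‖ ≤ C := by
      intro i
      have hK : IsCompact (Icc 0 T ×ˢ Metric.closedBall (0 : EuclideanSpace ℝ (Fin n)) R) :=
        isCompact_Icc.prod (isCompact_closedBall 0 R)
      obtain ⟨C, hC⟩ := hK.exists_bound_of_continuousOn
        ((continuousOn_flow (hf i)).mono fun p hp => hp.1.1)
      exact ⟨C, fun t ht x hx => hC (t, x) ⟨ht, mem_closedBall_zero_iff.2 hx⟩⟩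
    choose C hC using this
    obtain ⟨D, hD⟩ := (finite_range C).bddAbove
    refine ⟨D, ?_⟩
    rintro r - hr v ⟨i, t, ht, x, rfl, rfl⟩
    exact (hC i t ht x hr).trans (hD (mem_range_self i))
  · intro ε hε
    have : ∀ i, ∀ᶠ x in 𝓝 (0 : EuclideanSpace ℝ (Fin n)), ∀ t ∈ Icc 0 T,
        ‖flow (hf i) t x‖ ≤ ε := by
      intro i
      obtain ⟨C, hC⟩ := exists_dist_flow_le (hf i) 0 T
      have hlim : Tendsto (fun x : EuclideanSpace ℝ (Fin n) => C * ‖x‖) (𝓝 0) (𝓝 0) := by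
        have : Continuous fun x : EuclideanSpace ℝ (Fin n) => C * ‖x‖ := by fun_prop
        simpa using this.tendsto 0
      filter_upwards [hC, hlim.eventually (gt_mem_nhds hε)] with x h1 h2 t ht
      have := h1 t ht
      rw [flow_map_zero (hf i) ht.1, dist_zero_right, dist_zero_right] at this
      linarith
    obtain ⟨δ, hδ, h⟩ := Metric.eventually_nhds_iff.1 (eventually_all.2 this)
    refine ⟨δ / 2, by linarith, ?_⟩
    rintro r - hr v ⟨i, t, ht, x, rfl, rfl⟩
    exact h (by rw [dist_zero_right]; linarith) i t ht

end Flow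

theorem ClassK.classKL_exp_decay {γ δ : ℝ → ℝ} (hγ : ClassK γ) (hδ : ClassK δ) (c : ℝ) :
    ClassKL fun r t => γ (Real.exp (c - t) * δ r) where
  continuousOn := by
    have hδ' : ContinuousOn (fun p : ℝ × ℝ => δ p.1) (Ici 0 ×ˢ Ici 0) :=
      hδ.continuousOn.comp continuousOn_fst fun p hp => hp.1
    have hin : ContinuousOn (fun p : ℝ × ℝ => Real.exp (c - p.2) * δ p.1) (Ici 0 ×ˢ Ici 0) :=
      ContinuousOn.mul (by fun_prop) hδ'
    exact hγ.continuousOn.comp hin fun p hp => mul_nonneg (Real.exp_nonneg _) (hδ.nonneg hp.1)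
  classK := fun s _ => hγ.comp (hδ.const_mul (Real.exp_pos _))
  antitoneOn := fun r hr s _ t _ hst => by
    have h0 := hδ.nonneg hr
    exact hγ.mono (by positivity) (by gcongr)
  tendsto_zero := fun r hr => by
    have h0 := hδ.nonneg hr
    have h1 : Tendsto (fun t => Real.exp (c - t) * δ r) atTop (𝓝 0) := by
      have : Tendsto (fun t : ℝ => c - t) atTop atBot :=
        tendsto_atBot_add_const_left _ c tendsto_neg_atTop_atBot
      simpa using (Real.tendsto_exp_atBot.comp this).mul_const (δ r)
    have h2 : Tendsto (fun t => Real.exp (c - t) * δ r) atTop (𝓝[Ici 0] 0) :=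
      tendsto_nhdsWithin_iff.2 ⟨h1, Eventually.of_forall fun t => by
        simp only [mem_Ici]; positivity⟩
    have h3 := hγ.continuousOn 0 self_mem_Ici
    rw [ContinuousWithinAt, hγ.map_zero] at h3
    exact h3.comp h2

/-! ### Structure of switching signals, and Lyapunov functions imply stability. -/

section Signals

variable {n M : ℕ} {σ : ℝ≥0 → Fin M} {t : ℕ → ℝ≥0}

/-- Otherwise infinitely many switching instants would lie in [0, u]. -/
theorem IsSwitchingSequence.exists_mem_Ico (ht : IsSwitchingSequence σ t) (hσ : σ ∈ signals M)
    (u : ℝ≥0) : ∃ k, u ∈ Ico (t k) (t (k + 1)) := by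
  have hex : ∃ k, u < t (k + 1) := by
    by_contra! hcon
    have hsub : range t ⊆ insert 0 (discontinuities σ ∩ Iic u) := by
      rintro _ ⟨k, rfl⟩
      have : t k ∈ insert 0 (discontinuities σ) := ht.range_eq ▸ mem_range_self k
      rcases this with h | h
      · exact Or.inl h
      · exact Or.inr ⟨h, (ht.strictMono.monotone (Nat.le_succ k)).trans (hcon k)⟩
    exact infinite_range_of_injective ht.strictMono.injective (((hσ.2 u).insert 0).subset hsub)
  classical
  refine ⟨Nat.find hex, ?_, Nat.find_spec hex⟩
  rcases h : Nat.find hex with _ | k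
  · rw [ht.zero]; exact zero_le
  · exact not_lt.1 (Nat.find_min hex (h ▸ Nat.lt_succ_self k))

theorem IsSwitchingSequence.eq_of_mem_Ico (ht : IsSwitchingSequence σ t) (hσ : σ ∈ signals M)
    {k : ℕ} {u : ℝ≥0} (hu : u ∈ Ico (t k) (t (k + 1))) : σ u = σ (t k) := by
  refine (isPreconnected_Ico (a := t k) (b := t (k + 1))).constant ?_ hu
    ⟨le_rfl, ht.strictMono k.lt_succ_self⟩
  intro v hv
  rcases hv.1.eq_or_lt with rfl | hlt
  · exact (hσ.1 _).mono fun w hw => hw.1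
  · by_cases hc : ContinuousAt σ v
    · exact hc.continuousWithinAt
    · exfalso
      have : v ∈ range t := ht.range_eq ▸ Or.inr hc
      obtain ⟨j, rfl⟩ := this
      have h1 := ht.strictMono.lt_iff_lt.1 hlt
      have h2 := ht.strictMono.lt_iff_lt.1 hv.2
      omega

/-- Equal modes would make `σ` continuous at the later instant. This provides the i ≠ j of the
switching inequality. -/
theorem IsSwitchingSequence.ne_succ (ht : IsSwitchingSequence σ t) (hσ : σ ∈ signals M)
    (k : ℕ) : σ (t k) ≠ σ (t (k + 1)) := by
  intro heq
  have hlt : t k < t (k + 1) := ht.strictMono k.lt_succ_self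
  have hd : t (k + 1) ∈ insert 0 (discontinuities σ) := ht.range_eq ▸ mem_range_self _
  rcases hd with h0 | hd
  · rw [h0] at hlt
    exact not_lt_zero hlt
  · apply hd
    refine continuousAt_iff_continuous_left_right.2 ⟨?_, hσ.1 _⟩
    refine (continuousWithinAt_const (b := σ (t (k + 1)))).congr_of_eventuallyEq ?_ rfl
    filter_upwards [Ioc_mem_nhdsLE hlt] with u hu
    rcases hu.2.eq_or_lt with rfl | hu'
    · rfl
    · rw [ht.eq_of_mem_Ico hσ ⟨hu.1.le, hu'⟩, heq]

theorem IsSolution.eq_flow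
    {f : Fin M → EuclideanSpace ℝ (Fin n) → EuclideanSpace ℝ (Fin n)}
    (hf : ∀ i, IsRegular (f i)) {x₀ : EuclideanSpace ℝ (Fin n)}
    {x : ℝ → EuclideanSpace ℝ (Fin n)} (hx : IsSolution f σ x₀ x)
    (ht : IsSwitchingSequence σ t) (hσ : σ ∈ signals M) {k : ℕ} {u : ℝ}
    (hu : u ∈ Icc (t k : ℝ) (t (k + 1))) :
    x u = flow (hf (σ (t k))) (u - t k) (x (t k)) := by
  refine eq_flow_of_hasDerivWithinAt (hf (σ (t k))) (b := t (k + 1))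
    (hx.continuousOn.mono fun v hv => (t k).2.trans hv.1) ?_ u hu
  intro v hv
  have hv0 : 0 ≤ v := (t k).2.trans hv.1
  lift v to ℝ≥0 using hv0
  have h := hx.hasDerivWithinAt v
  rwa [ht.eq_of_mem_Ico hσ (k := k) ⟨by exact_mod_cast hv.1, by exact_mod_cast hv.2⟩] at h

theorem guas_star_of_hasLyapunovFunctions
    {f : Fin M → EuclideanSpace ℝ (Fin n) → EuclideanSpace ℝ (Fin n)}
    (hf : ∀ i, IsRegular (f i)) {τ₁ τ₂ : ℝ} (hτ₁ : 0 ≤ τ₁)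
    (h : HasLyapunovFunctions hf τ₁ τ₂) : GUAS f (dwellSignalsStar M τ₁ τ₂) := by
  obtain ⟨α₁, α₂, Vm, Vp, hα₁, hα₂, -, -, hVm, -, hflow, hswitch⟩ := h
  obtain ⟨χ, hχ, hχle, hχf⟩ := exists_flow_bound hf τ₂
  obtain ⟨ψ, hψ, hψle⟩ := hα₁.exists_inverse_bound
  -- The inner `χ` pays for the first interval, the outer one for the interval containing the
  -- current time.
  refine ⟨_, (hχ.toClassK.comp hψ.toClassK).classKL_exp_decay
    (hα₂.toClassK.comp hχ.toClassK) (2 * τ₂), ?_⟩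
  rintro σ ⟨hσ, t, ht, ht1, hdw⟩ x₀ x hx u hu
  lift u to ℝ≥0 using hu
  have hsol : ∀ {k : ℕ} {u : ℝ}, u ∈ Icc (t k : ℝ) (t (k + 1)) →
      x u = flow (hf (σ (t k))) (u - t k) (x (t k)) := fun hu => hx.eq_flow hf ht hσ hu
  have hle : ∀ k, (t k : ℝ) ≤ t (k + 1) := fun k =>
    NNReal.coe_le_coe.2 (ht.strictMono k.lt_succ_self).le
  have hlen : ∀ k, (t (k + 1) : ℝ) - t k ≤ τ₂ := by
    rintro (_ | k)
    · simpa [ht.zero] using ht1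
    · exact (hdw (k + 1) (by omega)).2
  have hτ₂ : 0 ≤ τ₂ := (t 1).2.trans ht1
  have hx0 : x (t 0) = x₀ := by simpa [ht.zero] using hx.initial
  have hx1 : ‖x (t 1)‖ ≤ χ ‖x₀‖ := by
    rw [hsol (k := 0) ⟨hle 0, le_rfl⟩, hx0]
    exact hχf _ _ ⟨sub_nonneg.2 (hle 0), hlen 0⟩ _
  -- Anchored at `t 1`, since the first interval may be shorter than `τ₁`.
  have hdecay : ∀ k, Vm (σ (t (k + 1))) (x (t (k + 1))) ≤
      Real.exp (t 1 - t (k + 1)) * Vm (σ (t 1)) (x (t 1)) := by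
    intro k
    induction k with
    | zero => simp
    | succ k ih =>
      obtain ⟨h1, h2⟩ := hdw (k + 1) (by omega)
      set s : ℝ := t (k + 2) - t (k + 1) - τ₁ with hs
      have hs0 : 0 ≤ s := by linarith
      have hxe : x (t (k + 2)) =
          flow (hf (σ (t (k + 1)))) τ₁ (flow (hf (σ (t (k + 1)))) s (x (t (k + 1)))) := by
        rw [hsol (k := k + 1) ⟨hle (k + 1), le_rfl⟩, flow_add _ hτ₁]
        congr 1
        rw [hs]; ring
      calc Vm (σ (t (k + 2))) (x (t (k + 2)))
          ≤ Real.exp (-τ₁) * Vp (σ (t (k + 1))) (flow (hf (σ (t (k + 1)))) s (x (t (k + 1)))) := by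
            rw [hxe]; exact hswitch _ _ (ht.ne_succ hσ (k + 1)) _
        _ ≤ Real.exp (-τ₁) * (Real.exp (-s) * Vm (σ (t (k + 1))) (x (t (k + 1)))) := by
            gcongr
            exact hflow _ s ⟨hs0, by linarith⟩ _
        _ ≤ Real.exp (-τ₁) * (Real.exp (-s) *
              (Real.exp (t 1 - t (k + 1)) * Vm (σ (t 1)) (x (t 1)))) := by gcongr
        _ = Real.exp (t 1 - t (k + 2)) * Vm (σ (t 1)) (x (t 1)) := by
            rw [← mul_assoc, ← mul_assoc, ← Real.exp_add, ← Real.exp_add]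
            congr 2
            rw [hs]; ring
  -- One `τ₂` compensates for `t 1 ≤ τ₂`, the other for the lag between `t k` and `v`.
  have hbound : ∀ k, ∀ v : ℝ, v ≤ t (k + 1) →
      α₁ ‖x (t k)‖ ≤ Real.exp (2 * τ₂ - v) * α₂ (χ ‖x₀‖) := by
    intro k v hv
    have hn : 0 ≤ α₂ (χ ‖x₀‖) := hα₂.nonneg (hχ.nonneg (norm_nonneg _))
    cases k with
    | zero =>
      have h1 := (hVm (σ (t 0)) (x (t 0))).1.trans (hVm (σ (t 0)) (x (t 0))).2
      have h2 : α₂ ‖x₀‖ ≤ α₂ (χ ‖x₀‖) := hα₂.mono (norm_nonneg _) (hχle _ (norm_nonneg _))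
      have h3 : 1 ≤ Real.exp (2 * τ₂ - v) := Real.one_le_exp (by
        simp only [zero_add] at hv; linarith)
      rw [hx0] at h1 ⊢
      nlinarith
    | succ k =>
      calc α₁ ‖x (t (k + 1))‖ ≤ Vm (σ (t (k + 1))) (x (t (k + 1))) := (hVm _ _).1
        _ ≤ _ := hdecay k
        _ ≤ Real.exp (t 1 - t (k + 1)) * α₂ (χ ‖x₀‖) := by
          gcongr
          exact (hVm _ _).2.trans (hα₂.mono (norm_nonneg _) hx1)
        _ ≤ _ := by
          refine mul_le_mul_of_nonneg_right (Real.exp_le_exp.2 ?_) hn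
          linarith [hlen (k + 1)]
  obtain ⟨k, hk⟩ := ht.exists_mem_Ico hσ u
  have hk1 : (t k : ℝ) ≤ u := NNReal.coe_le_coe.2 hk.1
  have hk2 : (u : ℝ) ≤ t (k + 1) := NNReal.coe_le_coe.2 hk.2.le
  rw [hsol (k := k) ⟨hk1, hk2⟩]
  refine (hχf _ _ ⟨sub_nonneg.2 hk1, by linarith [hlen k]⟩ _).trans ?_
  refine hχ.mono (norm_nonneg _) (hψle _ _ ?_ (norm_nonneg _) (hbound k u hk2))
  exact mul_nonneg (Real.exp_nonneg _) (hα₂.nonneg (hχ.nonneg (norm_nonneg _)))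

theorem dwellSignals_subset_star {τ₁ τ₂ : ℝ} :
    dwellSignals M τ₁ τ₂ ⊆ dwellSignalsStar M τ₁ τ₂ := by
  rintro σ ⟨hσ, t, ht, h⟩
  refine ⟨hσ, t, ht, ?_, fun k _ => h k⟩
  simpa [ht.zero] using (h 0).2

theorem GUAS.mono {f : Fin M → EuclideanSpace ℝ (Fin n) → EuclideanSpace ℝ (Fin n)}
    {S S' : Set (ℝ≥0 → Fin M)} (hS : S ⊆ S') (h : GUAS f S') : GUAS f S := by
  obtain ⟨β, hβ, hb⟩ := h
  exact ⟨β, hβ, fun σ hσ => hb σ (hS hσ)⟩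

end Signals

/-! ### Signals and solutions with prescribed instants and modes. -/

/-- The index of the interval `[t k, t (k + 1))` that contains `u`. -/
noncomputable def timeIndex (t : ℕ → ℝ≥0) (u : ℝ≥0) : ℕ := sInf {k | u < t (k + 1)}

section Construction

variable {n M : ℕ} {t : ℕ → ℝ≥0}

theorem mem_Ico_timeIndex (ht0 : t 0 = 0) (hub : ∀ u, ∃ k, u < t (k + 1)) (u : ℝ≥0) :
    u ∈ Ico (t (timeIndex t u)) (t (timeIndex t u + 1)) := by
  have hne : {k | u < t (k + 1)}.Nonempty := hub u
  refine ⟨?_, Nat.sInf_mem hne⟩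
  rcases h : timeIndex t u with _ | k
  · rw [ht0]; exact zero_le
  · have : k ∉ {k | u < t (k + 1)} := Nat.notMem_of_lt_sInf (by
      rw [timeIndex] at h; rw [h]; exact Nat.lt_succ_self k)
    exact not_lt.1 this

theorem timeIndex_eq (ht0 : t 0 = 0) (hmono : StrictMono t) (hub : ∀ u, ∃ k, u < t (k + 1))
    {u : ℝ≥0} {k : ℕ} (hu : u ∈ Ico (t k) (t (k + 1))) : timeIndex t u = k := by
  obtain ⟨h1, h2⟩ := mem_Ico_timeIndex ht0 hub u
  have h3 := hmono.lt_iff_lt.1 (h1.trans_lt hu.2)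
  have h4 := hmono.lt_iff_lt.1 (hu.1.trans_lt h2)
  omega

theorem eventually_timeIndex_eq (ht0 : t 0 = 0) (hmono : StrictMono t)
    (hub : ∀ u, ∃ k, u < t (k + 1)) {u : ℝ≥0} {k : ℕ} (hu : u ∈ Ico (t k) (t (k + 1))) :
    ∀ᶠ v in 𝓝[≥] u, timeIndex t v = k := by
  filter_upwards [Ico_mem_nhdsGE hu.2] with v hv
  exact timeIndex_eq ht0 hmono hub ⟨hu.1.trans hv.1, hv.2⟩

theorem isSwitchingSequence_timeIndex (ht0 : t 0 = 0) (hmono : StrictMono t)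
    (hub : ∀ u, ∃ k, u < t (k + 1)) {m : ℕ → Fin M} (hm : ∀ k, m k ≠ m (k + 1)) :
    (fun u => m (timeIndex t u)) ∈ signals M ∧
      IsSwitchingSequence (fun u => m (timeIndex t u)) t := by
  have hright : ∀ u, ContinuousWithinAt (fun u => m (timeIndex t u)) (Ici u) u := by
    intro u
    have hu := mem_Ico_timeIndex ht0 hub u
    refine (continuousWithinAt_const (b := m (timeIndex t u))).congr_of_eventuallyEq ?_ rfl
    filter_upwards [eventually_timeIndex_eq ht0 hmono hub hu] with v hv
    rw [hv]
  have hsub : discontinuities (fun u => m (timeIndex t u)) ⊆ range t := by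
    intro u hu
    have hk := mem_Ico_timeIndex ht0 hub u
    rcases hk.1.eq_or_lt with heq | hlt
    · exact ⟨_, heq⟩
    · exfalso
      apply hu
      refine (continuousAt_const (y := m (timeIndex t u))).congr ?_
      filter_upwards [Ioo_mem_nhds hlt hk.2] with v hv
      rw [timeIndex_eq ht0 hmono hub ⟨hv.1.le, hv.2⟩]
  -- The value just before `t (k + 1)` is `m k`, distinct from `m (k + 1)`, so every instant is a
  -- genuine switch.
  have hdisc : ∀ k, t (k + 1) ∈ discontinuities (fun u => m (timeIndex t u)) := by
    intro k hc
    have h1 : timeIndex t (t (k + 1)) = k + 1 :=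
      timeIndex_eq ht0 hmono hub ⟨le_rfl, hmono (k + 1).lt_succ_self⟩
    have h2 : ∀ᶠ v in 𝓝 (t (k + 1)), m (timeIndex t v) = m (k + 1) := by
      have h := hc.eventually ((isOpen_discrete {m (timeIndex t (t (k + 1)))}).mem_nhds rfl)
      rwa [h1] at h
    have hlt := hmono k.lt_succ_self
    have h3 : ∀ᶠ v in 𝓝[<] (t (k + 1)), timeIndex t v = k := by
      filter_upwards [Ico_mem_nhdsLT hlt] with v hv
      exact timeIndex_eq ht0 hmono hub hv
    have : (𝓝[<] (t (k + 1))).NeBot := nhdsLT_neBot_of_exists_lt ⟨_, hlt⟩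
    obtain ⟨v, hv1, hv2⟩ := ((h2.filter_mono nhdsWithin_le_nhds).and h3).exists
    rw [hv2] at hv1
    exact hm k hv1
  refine ⟨⟨hright, fun T => ?_⟩, ht0, hmono, ?_⟩
  · obtain ⟨K, hK⟩ := hub T
    refine ((finite_Iic (K + 1)).image t).subset ?_
    rintro u ⟨hu, huT⟩
    obtain ⟨k, rfl⟩ := hsub hu
    exact ⟨k, (hmono.lt_iff_lt.1 (lt_of_le_of_lt huT hK)).le, rfl⟩
  · apply Subset.antisymm
    · rintro _ ⟨_ | k, rfl⟩
      · exact Or.inl ht0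
      · exact Or.inr (hdisc k)
    · rintro u (rfl | hu)
      · exact ⟨0, ht0⟩
      · exact hsub hu

/-- `hX` makes consecutive flow pieces agree at the common instant, so each formula extends to the
closed interval; this gives left continuity. -/
theorem exists_isSolution {f : Fin M → EuclideanSpace ℝ (Fin n) → EuclideanSpace ℝ (Fin n)}
    (hf : ∀ i, IsRegular (f i)) (ht0 : t 0 = 0) (hmono : StrictMono t)
    (hub : ∀ u, ∃ k, u < t (k + 1)) (m : ℕ → Fin M) {X : ℕ → EuclideanSpace ℝ (Fin n)}
    (hX : ∀ k, X (k + 1) = flow (hf (m k)) (t (k + 1) - t k) (X k)) :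
    ∃ x : ℝ → EuclideanSpace ℝ (Fin n),
      IsSolution f (fun u => m (timeIndex t u)) (X 0) x ∧
      ∀ k, ∀ u ∈ Icc (t k : ℝ) (t (k + 1)), x u = flow (hf (m k)) (u - t k) (X k) := by
  set x : ℝ → EuclideanSpace ℝ (Fin n) := fun u =>
    flow (hf (m (timeIndex t u.toNNReal))) (u - t (timeIndex t u.toNNReal))
      (X (timeIndex t u.toNNReal)) with hx
  have hIco : ∀ k, ∀ u ∈ Ico (t k : ℝ) (t (k + 1)),
      x u = flow (hf (m k)) (u - t k) (X k) := by
    intro k u hu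
    have h0 : 0 ≤ u := (t k).2.trans hu.1
    lift u to ℝ≥0 using h0
    have : timeIndex t u = k := timeIndex_eq ht0 hmono hub
      ⟨by exact_mod_cast hu.1, by exact_mod_cast hu.2⟩
    simp only [hx, Real.toNNReal_coe, this]
  have hIcc : ∀ k, ∀ u ∈ Icc (t k : ℝ) (t (k + 1)),
      x u = flow (hf (m k)) (u - t k) (X k) := by
    intro k u hu
    rcases hu.2.eq_or_lt with rfl | hlt
    · rw [hIco (k + 1) _ ⟨le_rfl, NNReal.coe_lt_coe.2 (hmono (k + 1).lt_succ_self)⟩, sub_self,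
        flow_zero, hX]
    · exact hIco k u ⟨hu.1, hlt⟩
  have hd : ∀ k u, HasDerivAt (fun u => flow (hf (m k)) (u - t k) (X k))
      (f (m k) (flow (hf (m k)) (u - t k) (X k))) u := fun k u =>
    (hasDerivAt_flow (hf (m k)) (u - t k) (X k)).comp_sub_const u (t k)
  have hderiv : ∀ u : ℝ≥0,
      HasDerivWithinAt x (f (m (timeIndex t u)) (x u)) (Ici (u : ℝ)) u := by
    intro u
    have hu := mem_Ico_timeIndex ht0 hub u
    set k := timeIndex t u
    have hu1 : (t k : ℝ) ≤ u := NNReal.coe_le_coe.2 hu.1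
    have hu2 : (u : ℝ) < t (k + 1) := NNReal.coe_lt_coe.2 hu.2
    rw [hIco k u ⟨hu1, hu2⟩]
    refine (hd k u).hasDerivWithinAt.congr_of_eventuallyEq ?_ (hIco k u ⟨hu1, hu2⟩)
    filter_upwards [Ico_mem_nhdsGE hu2] with v hv
    exact hIco k v ⟨hu1.trans hv.1, hv.2⟩
  refine ⟨x, ⟨?_, ?_, hderiv⟩, hIcc⟩
  · have := hIcc 0 0 (by simp [ht0])
    simpa [ht0, flow_zero] using this
  · intro u hu
    lift u to ℝ≥0 using hu
    have hr : ContinuousWithinAt x (Ici (u : ℝ)) u := (hderiv u).continuousWithinAt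
    rcases eq_or_ne u 0 with rfl | hu0
    · simpa using hr
    · apply ContinuousAt.continuousWithinAt
      refine continuousAt_iff_continuous_left_right.2 ⟨?_, hr⟩
      have : ∃ k, t k < u ∧ u ≤ t (k + 1) := by
        have h := mem_Ico_timeIndex ht0 hub u
        rcases h.1.eq_or_lt with heq | hlt
        · rcases hk : timeIndex t u with _ | k
          · rw [hk, ht0] at heq
            exact absurd heq.symm hu0
          · rw [hk] at heq
            exact ⟨k, heq ▸ hmono k.lt_succ_self, heq.ge⟩
        · exact ⟨_, hlt, h.2.le⟩
      obtain ⟨k, h1, h2⟩ := this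
      have h1' : (t k : ℝ) < u := NNReal.coe_lt_coe.2 h1
      have h2' : (u : ℝ) ≤ t (k + 1) := NNReal.coe_le_coe.2 h2
      refine (hd k u).continuousAt.continuousWithinAt.congr_of_eventuallyEq ?_
        (hIcc k u ⟨h1'.le, h2'⟩)
      filter_upwards [Ioc_mem_nhdsLE h1'] with v hv
      exact hIcc k v ⟨hv.1.le, hv.2.trans h2'⟩

/-- The state after `k` steps, the `j`-th of which follows the `m j`-th flow for a time `d j`. -/
noncomputable def node {f : Fin M → EuclideanSpace ℝ (Fin n) → EuclideanSpace ℝ (Fin n)}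
    (hf : ∀ i, IsRegular (f i)) (m : ℕ → Fin M) (d : ℕ → ℝ) (x : EuclideanSpace ℝ (Fin n)) :
    ℕ → EuclideanSpace ℝ (Fin n)
  | 0 => x
  | k + 1 => flow (hf (m k)) (d k) (node hf m d x k)

variable {f : Fin M → EuclideanSpace ℝ (Fin n) → EuclideanSpace ℝ (Fin n)}

theorem node_congr (hf : ∀ i, IsRegular (f i)) {m m' : ℕ → Fin M} {d d' : ℕ → ℝ}
    (x : EuclideanSpace ℝ (Fin n)) {N : ℕ} (hm : ∀ k < N, m k = m' k) (hd : ∀ k < N, d k = d' k) :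
    node hf m d x N = node hf m' d' x N := by
  induction N with
  | zero => rfl
  | succ N ih =>
    simp only [node, ih (fun k hk => hm k (by omega)) (fun k hk => hd k (by omega)),
      hm N (by omega), hd N (by omega)]

/-- The recursion peels off the last step; prepending a mode to a run requires peeling off the
first. -/
theorem node_succ' (hf : ∀ i, IsRegular (f i)) (m : ℕ → Fin M) (d : ℕ → ℝ)
    (x : EuclideanSpace ℝ (Fin n)) (N : ℕ) :
    node hf m d x (N + 1) =
      node hf (fun k => m (k + 1)) (fun k => d (k + 1)) (flow (hf (m 0)) (d 0) x) N := by
  induction N with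
  | zero => rfl
  | succ N ih => rw [node, ih, node]

/-- Along a sequence of modes whose dwell times are bounded away from zero, a stability estimate
for switching signals applies to the concatenated flows. -/
theorem norm_flow_node_le {τ₁ τ₂ : ℝ} {β : ℝ → ℝ → ℝ}
    (hf : ∀ i, IsRegular (f i))
    (hβ : ∀ σ ∈ dwellSignals M τ₁ τ₂, ∀ (x₀ : EuclideanSpace ℝ (Fin n))
      (x : ℝ → EuclideanSpace ℝ (Fin n)), IsSolution f σ x₀ x → ∀ t : ℝ, 0 ≤ t → ‖x t‖ ≤ β ‖x₀‖ t)
    {m : ℕ → Fin M} (hm : ∀ k, m k ≠ m (k + 1)) {d : ℕ → ℝ} {ε : ℝ} (hε : 0 < ε)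
    (hdε : ∀ k, ε ≤ d k) (hd : ∀ k, τ₁ ≤ d k ∧ d k ≤ τ₂) (x : EuclideanSpace ℝ (Fin n))
    (N : ℕ) {s : ℝ} (hs : s ∈ Icc 0 (d N)) :
    ‖flow (hf (m N)) s (node hf m d x N)‖ ≤ β ‖x‖ (∑ k ∈ Finset.range N, d k + s) := by
  have hd0 : ∀ k, 0 ≤ d k := fun k => hε.le.trans (hdε k)
  set t : ℕ → ℝ≥0 := fun k => ∑ j ∈ Finset.range k, (d j).toNNReal with ht
  have htc : ∀ k, (t k : ℝ) = ∑ j ∈ Finset.range k, d j := fun k => by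
    simp [ht, NNReal.coe_sum, Real.coe_toNNReal _ (hd0 _)]
  have hts : ∀ k, (t (k + 1) : ℝ) - t k = d k := fun k => by
    rw [htc, htc, Finset.sum_range_succ]; ring
  have ht0 : t 0 = 0 := by simp [ht]
  have hmono : StrictMono t := strictMono_nat_of_lt_succ fun k => by
    rw [← NNReal.coe_lt_coe]
    linarith [hts k, hdε k]
  have hub : ∀ u, ∃ k, u < t (k + 1) := by
    intro u
    obtain ⟨k, hk⟩ := exists_nat_gt ((u : ℝ) / ε)
    refine ⟨k, ?_⟩
    rw [div_lt_iff₀ hε] at hk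
    have h1 : (k : ℝ) * ε ≤ t k := by
      rw [htc]
      calc (k : ℝ) * ε = ∑ j ∈ Finset.range k, ε := by simp
        _ ≤ _ := Finset.sum_le_sum fun j _ => hdε j
    rw [← NNReal.coe_lt_coe]
    linarith [hts k, hdε k]
  obtain ⟨hσ, hsw⟩ := isSwitchingSequence_timeIndex ht0 hmono hub hm
  obtain ⟨y, hy, hyt⟩ := exists_isSolution hf ht0 hmono hub m (X := node hf m d x)
    fun k => by rw [hts]; rfl
  have h := hβ _ ⟨hσ, t, hsw, fun k => by rw [hts]; exact hd k⟩ _ _ hy (t N + s)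
    (add_nonneg (t N).2 hs.1)
  rw [hyt N _ ⟨by linarith [hs.1], by linarith [hs.2, hts N]⟩, htc, add_sub_cancel_left] at h
  exact h

end Construction

/-! ### Finite runs and their stability estimates. -/

/-- A finite succession of modes: the modes `mode 0, …, mode (steps - 1)` are active during
`dur 0, …, dur (steps - 1) ∈ [τ₁, τ₂]`, then `mode steps` during `last ∈ [0, τ₂]`. -/
structure Run (M : ℕ) (τ₁ τ₂ : ℝ) where
  mode : ℕ → Fin M
  dur : ℕ → ℝ
  steps : ℕ
  last : ℝ
  mode_ne : ∀ k < steps, mode k ≠ mode (k + 1)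
  dur_mem : ∀ k < steps, dur k ∈ Icc τ₁ τ₂
  last_mem : last ∈ Icc 0 τ₂

variable {n M : ℕ} {τ₁ τ₂ : ℝ} {f : Fin M → EuclideanSpace ℝ (Fin n) → EuclideanSpace ℝ (Fin n)}

namespace Run

/-- The total duration. -/
noncomputable def time (r : Run M τ₁ τ₂) : ℝ := ∑ k ∈ Finset.range r.steps, r.dur k + r.last

/-- The state reached from `x`. -/
noncomputable def endpoint (hf : ∀ i, IsRegular (f i)) (r : Run M τ₁ τ₂)
    (x : EuclideanSpace ℝ (Fin n)) : EuclideanSpace ℝ (Fin n) :=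
  flow (hf (r.mode r.steps)) r.last (node hf r.mode r.dur x r.steps)

theorem time_nonneg (hτ₁ : 0 ≤ τ₁) (r : Run M τ₁ τ₂) : 0 ≤ r.time :=
  add_nonneg (Finset.sum_nonneg fun k hk =>
    hτ₁.trans (r.dur_mem k (Finset.mem_range.1 hk)).1) r.last_mem.1

/-- The run that stays in mode `i`. -/
def stay (τ₁ : ℝ) (i : Fin M) {t : ℝ} (ht : t ∈ Icc 0 τ₂) : Run M τ₁ τ₂ where
  mode _ := i
  dur _ := 0
  steps := 0
  last := t
  mode_ne := fun _ h => absurd h (Nat.not_lt_zero _)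
  dur_mem := fun _ h => absurd h (Nat.not_lt_zero _)
  last_mem := ht

theorem time_stay (i : Fin M) {t : ℝ} (ht : t ∈ Icc 0 τ₂) : (stay τ₁ i ht).time = t := by
  simp [time, stay]

theorem endpoint_stay (hf : ∀ i, IsRegular (f i)) (i : Fin M) {t : ℝ} (ht : t ∈ Icc 0 τ₂)
    (x : EuclideanSpace ℝ (Fin n)) : (stay τ₁ i ht).endpoint hf x = flow (hf i) t x := rfl

/-- Prepend mode `i` for a duration `t`. -/
def cons (i : Fin M) {t : ℝ} (ht : t ∈ Icc τ₁ τ₂) (r : Run M τ₁ τ₂) (hi : i ≠ r.mode 0) :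
    Run M τ₁ τ₂ where
  mode k := Nat.casesOn k i r.mode
  dur k := Nat.casesOn k t r.dur
  steps := r.steps + 1
  last := r.last
  mode_ne := by
    rintro (_ | k) hk
    · exact hi
    · exact r.mode_ne k (by omega)
  dur_mem := by
    rintro (_ | k) hk
    · exact ht
    · exact r.dur_mem k (by omega)
  last_mem := r.last_mem

theorem time_cons (i : Fin M) {t : ℝ} (ht : t ∈ Icc τ₁ τ₂) (r : Run M τ₁ τ₂)
    (hi : i ≠ r.mode 0) : (cons i ht r hi).time = t + r.time := by
  simp only [time, cons, Finset.sum_range_succ']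
  change _ + t + r.last = _
  ring

theorem endpoint_cons (hf : ∀ i, IsRegular (f i)) (i : Fin M) {t : ℝ} (ht : t ∈ Icc τ₁ τ₂)
    (r : Run M τ₁ τ₂) (hi : i ≠ r.mode 0) (x : EuclideanSpace ℝ (Fin n)) :
    (cons i ht r hi).endpoint hf x = r.endpoint hf (flow (hf i) t x) := by
  simp only [endpoint, cons, node_succ']
  rfl

end Run

theorem continuousOn_node_max (hf : ∀ i, IsRegular (f i)) (m : ℕ → Fin M) (d : ℕ → ℝ)
    (x : EuclideanSpace ℝ (Fin n)) (N : ℕ) :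
    ContinuousOn (fun ε => node hf m (fun k => max (d k) ε) x N) (Ici 0) := by
  induction N with
  | zero => exact continuousOn_const
  | succ N ih =>
    refine (continuousOn_flow (hf (m N))).comp
      (f := fun ε => (max (d N) ε, node hf m (fun k => max (d k) ε) x N)) ?_ ?_
    · exact ContinuousOn.prodMk (by fun_prop) ih
    · exact fun ε hε => le_max_of_le_right (mem_Ici.1 hε)

/-- Raising durations to at least ε > 0 and appending an endless alternation of two modes gives an
admissible signal; continuity of both sides allows ε → 0. -/
theorem norm_endpoint_le_of_dwell (hf : ∀ i, IsRegular (f i)) (hτ₁ : 0 ≤ τ₁) (hτ : τ₁ ≤ τ₂)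
    (hτ₂ : 0 < τ₂) [Nontrivial (Fin M)] {β : ℝ → ℝ → ℝ} (hKL : ClassKL β)
    (hβ : ∀ σ ∈ dwellSignals M τ₁ τ₂, ∀ (x₀ : EuclideanSpace ℝ (Fin n))
      (x : ℝ → EuclideanSpace ℝ (Fin n)), IsSolution f σ x₀ x → ∀ t : ℝ, 0 ≤ t → ‖x t‖ ≤ β ‖x₀‖ t)
    (r : Run M τ₁ τ₂) (x : EuclideanSpace ℝ (Fin n)) :
    ‖r.endpoint hf x‖ ≤ β ‖x‖ r.time := by
  obtain ⟨m, d, N, s, hm, hd, hs⟩ := r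
  simp only [Run.endpoint, Run.time]
  obtain ⟨b, hb⟩ := exists_ne (m N)
  set m' : ℕ → Fin M := fun k => if k ≤ N then m k else if Even (k - N) then m N else b with hm'
  have hmm : ∀ k ≤ N, m' k = m k := fun k hk => if_pos hk
  have hmeven : ∀ j, m' (N + j) = if Even j then m N else b := by
    rintro (_ | j)
    · simp [hm']
    · simp [hm']
  have hne : ∀ k, m' k ≠ m' (k + 1) := by
    intro k
    rcases lt_or_ge k N with hk | hk
    · rw [hmm k hk.le, hmm (k + 1) hk]
      exact hm k hk
    · obtain ⟨j, rfl⟩ := Nat.exists_eq_add_of_le hk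
      rw [add_assoc, hmeven, hmeven]
      by_cases hj : Even j
      · simpa [hj, Nat.even_add_one] using hb.symm
      · simpa [hj, Nat.even_add_one] using hb
  have hpert : ∀ ε ∈ Ioc 0 τ₂,
      ‖flow (hf (m N)) s (node hf m (fun k => max (d k) ε) x N)‖ ≤
        β ‖x‖ (∑ k ∈ Finset.range N, max (d k) ε + s) := by
    intro ε hε
    -- Interval `N` gets full length `τ₂`, so the final stretch `s` fits inside it.
    set d' : ℕ → ℝ := fun k => if k < N then max (d k) ε else τ₂ with hd'
    have hdd : ∀ k < N, d' k = max (d k) ε := fun k hk => if_pos hk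
    have hdN : d' N = τ₂ := if_neg (lt_irrefl N)
    have h := norm_flow_node_le hf hβ hne (d := d') hε.1 (fun k => ?_) (fun k => ?_) x N (s := s)
      (by rw [hdN]; exact hs)
    · rw [node_congr hf x (fun k hk => hmm k (le_of_lt hk)) hdd,
        Finset.sum_congr rfl (fun k hk => hdd k (Finset.mem_range.1 hk))] at h
      simpa only [hmm N le_rfl] using h
    · simp only [hd']
      split_ifs with hk
      · exact le_max_right _ _
      · exact hε.2
    · simp only [hd']
      split_ifs with hk
      · exact ⟨(hd k hk).1.trans (le_max_left _ _), max_le (hd k hk).2 hε.2⟩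
      · exact ⟨hτ, le_rfl⟩
  have hc1 : ContinuousOn (fun ε => ‖flow (hf (m N)) s (node hf m (fun k => max (d k) ε) x N)‖)
      (Ici 0) :=
    ((continuous_flow (hf (m N)) hs.1).comp_continuousOn
      (continuousOn_node_max hf m d x N)).norm
  have hc2 : ContinuousOn (fun ε => β ‖x‖ (∑ k ∈ Finset.range N, max (d k) ε + s)) (Ici 0) := by
    refine hKL.continuousOn.comp
      (f := fun ε : ℝ => (‖x‖, ∑ k ∈ Finset.range N, max (d k) ε + s)) ?_ ?_
    · fun_prop
    · intro ε hε
      exact ⟨norm_nonneg x, add_nonneg (Finset.sum_nonneg fun k _ =>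
        le_max_of_le_right (mem_Ici.1 hε)) hs.1⟩
  have hmax : ∀ k < N, max (d k) 0 = d k := fun k hk => max_eq_left (hτ₁.trans (hd k hk).1)
  have hlim := le_of_tendsto_of_tendsto
    ((hc1 0 self_mem_Ici).mono_left (nhdsWithin_mono 0 Ioi_subset_Ici_self))
    ((hc2 0 self_mem_Ici).mono_left (nhdsWithin_mono 0 Ioi_subset_Ici_self))
    (by filter_upwards [Ioc_mem_nhdsGT hτ₂] with ε hε using hpert ε hε)
  beta_reduce at hlim
  rwa [node_congr hf x (fun _ _ => rfl) hmax,
    Finset.sum_congr rfl (fun k hk => hmax k (Finset.mem_range.1 hk))] at hlim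

theorem exists_norm_endpoint_le (hf : ∀ i, IsRegular (f i)) (hτ₁ : 0 ≤ τ₁) (hτ : τ₁ ≤ τ₂)
    (h : GUAS f (dwellSignals M τ₁ τ₂)) :
    ∃ β : ℝ → ℝ → ℝ, ClassKL β ∧ ∀ (r : Run M τ₁ τ₂) (x : EuclideanSpace ℝ (Fin n)),
      ‖r.endpoint hf x‖ ≤ β ‖x‖ r.time := by
  -- In these cases no admissible signal exists and the stability hypothesis is vacuous; but
  -- completed steps of a run never move the state, so only `last ≤ τ₂` matters.
  by_cases hdeg : τ₂ = 0 ∨ Subsingleton (Fin M)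
  · obtain ⟨χ, hχ, hχle, hχf⟩ := exists_flow_bound hf τ₂
    refine ⟨_, hχ.toClassK.classKL_exp_decay hχ.toClassK τ₂, fun r x => ?_⟩
    have hnode : ∀ k ≤ r.steps, node hf r.mode r.dur x k = x ∧
        ∑ j ∈ Finset.range k, r.dur j = 0 := by
      intro k
      induction k with
      | zero => exact fun _ => ⟨rfl, by simp⟩
      | succ k ih =>
        intro hk
        obtain ⟨h1, h2⟩ := ih (by omega)
        rcases hdeg with h0 | hsub
        · have hd := r.dur_mem k hk
          have hd0 : r.dur k = 0 := le_antisymm (hd.2.trans h0.le) (hτ₁.trans hd.1)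
          exact ⟨by rw [node, h1, hd0, flow_zero], by rw [Finset.sum_range_succ, h2, hd0, add_zero]⟩
        · exact absurd (Subsingleton.elim _ _) (r.mode_ne k hk)
    obtain ⟨h1, h2⟩ := hnode r.steps le_rfl
    simp only [Run.endpoint, Run.time, h1, h2, zero_add]
    refine (hχf _ _ r.last_mem x).trans (hχ.mono (norm_nonneg x) ?_)
    have h3 : 1 ≤ Real.exp (τ₂ - r.last) := Real.one_le_exp (by linarith [r.last_mem.2])
    have h4 := hχle ‖x‖ (norm_nonneg x)
    nlinarith [norm_nonneg x]
  · rw [not_or, not_subsingleton_iff_nontrivial] at hdeg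
    obtain ⟨h0, hnt⟩ := hdeg
    obtain ⟨β, hKL, hβ⟩ := h
    exact ⟨β, hKL, norm_endpoint_le_of_dwell hf hτ₁ hτ
      (lt_of_le_of_ne (hτ₁.trans hτ) (Ne.symm h0)) hKL hβ⟩

/-- All runs from the ball of radius `R` remain in the ball of radius β(R,0), so one Lipschitz
constant serves every mode and Grönwall composes along the run. -/
theorem exists_dist_endpoint_le (hf : ∀ i, IsRegular (f i)) (hτ₁ : 0 ≤ τ₁)
    {β : ℝ → ℝ → ℝ} (hKL : ClassKL β)
    (hβ : ∀ (r : Run M τ₁ τ₂) (x : EuclideanSpace ℝ (Fin n)), ‖r.endpoint hf x‖ ≤ β ‖x‖ r.time)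
    (R : ℝ) :
    ∃ K : ℝ≥0, ∀ (r : Run M τ₁ τ₂) (x y : EuclideanSpace ℝ (Fin n)), ‖x‖ ≤ R → ‖y‖ ≤ R →
      dist (r.endpoint hf x) (r.endpoint hf y) ≤ dist x y * Real.exp (K * r.time) := by
  choose K hK using fun i => (hf i).exists_lipschitzOnWith (β R 0)
  refine ⟨Finset.univ.sup K, fun r x y hx hy => ?_⟩
  have hK' : ∀ i, LipschitzOnWith (Finset.univ.sup K) (f i) (Metric.closedBall 0 (β R 0)) :=
    fun i => (hK i).weaken (Finset.le_sup (Finset.mem_univ i))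
  have hball : ∀ z : EuclideanSpace ℝ (Fin n), ‖z‖ ≤ R → ∀ k ≤ r.steps, ∀ s ∈ Icc 0 τ₂,
      ‖flow (hf (r.mode k)) s (node hf r.mode r.dur z k)‖ ≤ β R 0 := by
    intro z hz k hk s hs
    -- An intermediate state is the endpoint of a truncated run.
    let r' : Run M τ₁ τ₂ := ⟨r.mode, r.dur, k, s, fun j hj => r.mode_ne j (by omega),
      fun j hj => r.dur_mem j (by omega), hs⟩
    have hR : 0 ≤ R := (norm_nonneg z).trans hz
    have ht := r'.time_nonneg hτ₁
    exact ((hβ r' z).trans ((hKL.classK _ ht).mono (norm_nonneg z) hz)).trans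
      (hKL.antitoneOn R hR self_mem_Ici ht ht)
  have hstep : ∀ k ≤ r.steps, ∀ s ∈ Icc 0 τ₂,
      dist (flow (hf (r.mode k)) s (node hf r.mode r.dur x k))
        (flow (hf (r.mode k)) s (node hf r.mode r.dur y k)) ≤
      dist (node hf r.mode r.dur x k) (node hf r.mode r.dur y k) *
        Real.exp ((Finset.univ.sup K : ℝ≥0) * s) := by
    intro k hk s hs
    exact dist_flow_le_of_mem_closedBall (hf _) (hK' _) hs.1
      (fun u hu => hball x hx k hk u ⟨hu.1, hu.2.le.trans hs.2⟩)
      (fun u hu => hball y hy k hk u ⟨hu.1, hu.2.le.trans hs.2⟩)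
  have hnode : ∀ k ≤ r.steps, dist (node hf r.mode r.dur x k) (node hf r.mode r.dur y k) ≤
      dist x y * Real.exp ((Finset.univ.sup K : ℝ≥0) * ∑ j ∈ Finset.range k, r.dur j) := by
    intro k
    induction k with
    | zero => intro _; simp [node]
    | succ k ih =>
      intro hk
      have hd := r.dur_mem k hk
      refine (hstep k (by omega) (r.dur k) ⟨hτ₁.trans hd.1, hd.2⟩).trans ?_
      rw [Finset.sum_range_succ, mul_add, Real.exp_add, ← mul_assoc]
      gcongr
      exact ih (by omega)
  refine (hstep r.steps le_rfl r.last r.last_mem).trans ?_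
  rw [Run.time, mul_add, Real.exp_add, ← mul_assoc]
  gcongr
  exact hnode r.steps le_rfl

/-! ### Value function and converse Lyapunov theorem. -/

/-- The value function: the supremum, over the runs that start in mode `i`, of the exponentially
weighted size of the final state. -/
noncomputable def valueFunction (τ₁ τ₂ : ℝ) (hf : ∀ i, IsRegular (f i)) (α : ℝ → ℝ) (i : Fin M)
    (x : EuclideanSpace ℝ (Fin n)) : ℝ :=
  ⨆ r : {r : Run M τ₁ τ₂ // r.mode 0 = i}, Real.exp r.1.time * α ‖r.1.endpoint hf x‖

section ValueFunction

variable {α ρ : ℝ → ℝ}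

theorem value_le (hf : ∀ i, IsRegular (f i))
    (hbound : ∀ (r : Run M τ₁ τ₂) (x : EuclideanSpace ℝ (Fin n)),
      α ‖r.endpoint hf x‖ * Real.exp (2 * r.time) ≤ ρ ‖x‖)
    (r : Run M τ₁ τ₂) (x : EuclideanSpace ℝ (Fin n)) :
    Real.exp r.time * α ‖r.endpoint hf x‖ ≤ Real.exp (-r.time) * ρ ‖x‖ := by
  calc Real.exp r.time * α ‖r.endpoint hf x‖
      = Real.exp (-r.time) * (α ‖r.endpoint hf x‖ * Real.exp (2 * r.time)) := by
        rw [show r.time = -r.time + 2 * r.time by ring, Real.exp_add]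
        ring_nf
    _ ≤ _ := by gcongr; exact hbound r x

theorem value_le_valueFunction (hf : ∀ i, IsRegular (f i)) (hτ₁ : 0 ≤ τ₁) (hρ : ClassK ρ)
    (hbound : ∀ (r : Run M τ₁ τ₂) (x : EuclideanSpace ℝ (Fin n)),
      α ‖r.endpoint hf x‖ * Real.exp (2 * r.time) ≤ ρ ‖x‖)
    (r : Run M τ₁ τ₂) {i : Fin M} (hr : r.mode 0 = i) (x : EuclideanSpace ℝ (Fin n)) :
    Real.exp r.time * α ‖r.endpoint hf x‖ ≤ valueFunction τ₁ τ₂ hf α i x := by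
  have hb : BddAbove (range fun r : {r : Run M τ₁ τ₂ // r.mode 0 = i} =>
      Real.exp r.1.time * α ‖r.1.endpoint hf x‖) := by
    refine ⟨ρ ‖x‖, ?_⟩
    rintro _ ⟨r, rfl⟩
    refine (value_le hf hbound r.1 x).trans (mul_le_of_le_one_left (hρ.nonneg (norm_nonneg x)) ?_)
    rw [Real.exp_le_one_iff]
    linarith [r.1.time_nonneg hτ₁]
  exact le_ciSup hb ⟨r, hr⟩

theorem valueFunction_le (hf : ∀ i, IsRegular (f i)) (hτ₂ : 0 ≤ τ₂) {i : Fin M} {C : ℝ}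
    {x : EuclideanSpace ℝ (Fin n)}
    (h : ∀ r : Run M τ₁ τ₂, r.mode 0 = i → Real.exp r.time * α ‖r.endpoint hf x‖ ≤ C) :
    valueFunction τ₁ τ₂ hf α i x ≤ C := by
  have : Nonempty {r : Run M τ₁ τ₂ // r.mode 0 = i} := ⟨Run.stay τ₁ i ⟨le_rfl, hτ₂⟩, rfl⟩
  exact ciSup_le fun r => h r.1 r.2

theorem exp_mul_flow_le_valueFunction (hf : ∀ i, IsRegular (f i)) (hτ₁ : 0 ≤ τ₁) (hρ : ClassK ρ)
    (hbound : ∀ (r : Run M τ₁ τ₂) (x : EuclideanSpace ℝ (Fin n)),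
      α ‖r.endpoint hf x‖ * Real.exp (2 * r.time) ≤ ρ ‖x‖) (i : Fin M) {t : ℝ}
    (ht : t ∈ Icc 0 τ₂) (x : EuclideanSpace ℝ (Fin n)) :
    Real.exp t * α ‖flow (hf i) t x‖ ≤ valueFunction τ₁ τ₂ hf α i x := by
  have := value_le_valueFunction hf hτ₁ hρ hbound (Run.stay τ₁ i ht) (i := i) rfl x
  rwa [Run.time_stay, Run.endpoint_stay] at this

/-- Dynamic programming: prepending mode `i` to a run starting in mode `j` is a competitor for `i`.
-/
theorem exp_mul_valueFunction_le (hf : ∀ i, IsRegular (f i)) (hτ₁ : 0 ≤ τ₁) (hτ : τ₁ ≤ τ₂)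
    (hρ : ClassK ρ) (hbound : ∀ (r : Run M τ₁ τ₂) (x : EuclideanSpace ℝ (Fin n)),
      α ‖r.endpoint hf x‖ * Real.exp (2 * r.time) ≤ ρ ‖x‖) {i j : Fin M} (hij : i ≠ j) {t : ℝ}
    (ht : t ∈ Icc τ₁ τ₂) (x : EuclideanSpace ℝ (Fin n)) :
    Real.exp t * valueFunction τ₁ τ₂ hf α j (flow (hf i) t x) ≤ valueFunction τ₁ τ₂ hf α i x := by
  rw [← le_div_iff₀' (Real.exp_pos t)]
  refine valueFunction_le hf (hτ₁.trans hτ) fun r hr => ?_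
  rw [le_div_iff₀' (Real.exp_pos t), ← mul_assoc, ← Real.exp_add]
  have := value_le_valueFunction hf hτ₁ hρ hbound (Run.cons i ht r (hr ▸ hij)) (i := i) rfl x
  rwa [Run.time_cons, Run.endpoint_cons] at this

/-- Runs longer than some `T` contribute less than ε/2, uniformly on a ball; the shorter ones are
equicontinuous by `exists_dist_endpoint_le`. -/
theorem continuous_valueFunction (hf : ∀ i, IsRegular (f i)) (hτ₁ : 0 ≤ τ₁) (hτ : τ₁ ≤ τ₂)
    {β : ℝ → ℝ → ℝ} (hKL : ClassKL β)
    (hβ : ∀ (r : Run M τ₁ τ₂) (x : EuclideanSpace ℝ (Fin n)), ‖r.endpoint hf x‖ ≤ β ‖x‖ r.time)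
    (hα : ClassK α) (hρ : ClassK ρ)
    (hbound : ∀ (r : Run M τ₁ τ₂) (x : EuclideanSpace ℝ (Fin n)),
      α ‖r.endpoint hf x‖ * Real.exp (2 * r.time) ≤ ρ ‖x‖) (i : Fin M) :
    Continuous (valueFunction τ₁ τ₂ hf α i) := by
  have hτ₂ := hτ₁.trans hτ
  rw [Metric.continuous_iff]
  intro x₀ ε hε
  set R := ‖x₀‖ + 1 with hR
  have hR0 : 0 ≤ R := by positivity
  obtain ⟨K, hK⟩ := exists_dist_endpoint_le hf hτ₁ hKL hβ R
  obtain ⟨T, hT0, hT⟩ : ∃ T, 0 ≤ T ∧ Real.exp (-T) * ρ R < ε / 2 := by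
    have hlim : Tendsto (fun T => Real.exp (-T) * ρ R) atTop (𝓝 0) := by
      simpa using Real.tendsto_exp_neg_atTop_nhds_zero.mul_const (ρ R)
    exact ((eventually_ge_atTop 0).and (hlim.eventually (gt_mem_nhds (half_pos hε)))).exists
  have huc : UniformContinuousOn α (Icc 0 (β R 0)) :=
    isCompact_Icc.uniformContinuousOn_of_continuous (hα.continuousOn.mono fun s hs => hs.1)
  -- The factor e^{-T} offsets the weight, at most e^T on the shorter runs.
  obtain ⟨η, hη, hαη⟩ := Metric.uniformContinuousOn_iff.1 huc (ε / 2 * Real.exp (-T)) (by positivity)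
  have hend : ∀ (r : Run M τ₁ τ₂) (x : EuclideanSpace ℝ (Fin n)), ‖x‖ ≤ R →
      ‖r.endpoint hf x‖ ∈ Icc 0 (β R 0) := by
    intro r x hx
    have ht := r.time_nonneg hτ₁
    exact ⟨norm_nonneg _, ((hβ r x).trans ((hKL.classK _ ht).mono (norm_nonneg x) hx)).trans
      (hKL.antitoneOn R hR0 self_mem_Ici ht ht)⟩
  have hmain : ∀ x y : EuclideanSpace ℝ (Fin n), ‖x‖ ≤ R → ‖y‖ ≤ R →
      dist x y * Real.exp (K * T) < η →
      valueFunction τ₁ τ₂ hf α i x ≤ valueFunction τ₁ τ₂ hf α i y + ε / 2 := by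
    intro x y hx hy hxy
    refine valueFunction_le hf hτ₂ fun r hr => ?_
    have hle := value_le_valueFunction hf hτ₁ hρ hbound r hr y
    have hy0 : 0 ≤ Real.exp r.time * α ‖r.endpoint hf y‖ :=
      mul_nonneg (Real.exp_nonneg _) (hα.nonneg (norm_nonneg _))
    rcases le_total T r.time with hTr | hTr
    · have h1 := value_le hf hbound r x
      have h2 : Real.exp (-r.time) * ρ ‖x‖ ≤ Real.exp (-T) * ρ R :=
        mul_le_mul (Real.exp_le_exp.2 (by linarith)) (hρ.mono (norm_nonneg x) hx)
          (hρ.nonneg (norm_nonneg x)) (Real.exp_nonneg _)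
      linarith
    · have h1 : dist ‖r.endpoint hf x‖ ‖r.endpoint hf y‖ < η := by
        refine (dist_norm_norm_le _ _).trans_lt ?_
        rw [← dist_eq_norm]
        refine (hK r x y hx hy).trans_lt (lt_of_le_of_lt ?_ hxy)
        gcongr
      have h2 := hαη _ (hend r x hx) _ (hend r y hy) h1
      rw [Real.dist_eq] at h2
      have h3 := (le_abs_self _).trans h2.le
      have h4 : Real.exp r.time * (α ‖r.endpoint hf x‖ - α ‖r.endpoint hf y‖) ≤ ε / 2 := by
        calc _ ≤ Real.exp r.time * (ε / 2 * Real.exp (-T)) := by gcongr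
          _ ≤ Real.exp T * (ε / 2 * Real.exp (-T)) := by gcongr
          _ = ε / 2 * (Real.exp T * Real.exp (-T)) := by ring
          _ = ε / 2 := by rw [← Real.exp_add, add_neg_cancel, Real.exp_zero, mul_one]
      rw [mul_sub] at h4
      linarith
  refine ⟨min 1 (η * Real.exp (-(K * T))), by positivity, fun x hx => ?_⟩
  have hx1 : ‖x‖ ≤ R := by
    have h1 := hx.trans_le (min_le_left _ _)
    have h2 := norm_le_norm_add_norm_sub' x x₀
    rw [dist_eq_norm] at h1
    linarith
  have hx0 : ‖x₀‖ ≤ R := by linarith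
  have hd : dist x x₀ * Real.exp (K * T) < η := by
    have h1 := hx.trans_le (min_le_right _ _)
    calc _ < η * Real.exp (-(K * T)) * Real.exp (K * T) := by gcongr
      _ = η := by rw [mul_assoc, ← Real.exp_add, neg_add_cancel, Real.exp_zero, mul_one]
  have h1 := hmain x x₀ hx1 hx0 hd
  have h2 := hmain x₀ x hx0 hx1 (by rwa [dist_comm])
  rw [Real.dist_eq, abs_lt]
  constructor <;> linarith

theorem hasLyapunovFunctions_of_guas (hf : ∀ i, IsRegular (f i)) (hτ₁ : 0 ≤ τ₁) (hτ : τ₁ ≤ τ₂)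
    (h : GUAS f (dwellSignals M τ₁ τ₂)) : HasLyapunovFunctions hf τ₁ τ₂ := by
  obtain ⟨β, hKL, hβ⟩ := exists_norm_endpoint_le hf hτ₁ hτ h
  obtain ⟨α, ρ, hα, hρ, hαρ⟩ := hKL.exists_exp_bound
  have hτ₂ := hτ₁.trans hτ
  have hbound : ∀ (r : Run M τ₁ τ₂) (x : EuclideanSpace ℝ (Fin n)),
      α ‖r.endpoint hf x‖ * Real.exp (2 * r.time) ≤ ρ ‖x‖ := fun r x =>
    (mul_le_mul_of_nonneg_right (hα.mono (norm_nonneg _) (hβ r x)) (Real.exp_nonneg _)).trans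
      (hαρ _ _ (norm_nonneg x) (r.time_nonneg hτ₁))
  set V := valueFunction τ₁ τ₂ hf α with hV
  have hVc : ∀ i, Continuous (V i) :=
    continuous_valueFunction hf hτ₁ hτ hKL hβ hα.toClassK hρ.toClassK hbound
  have hVlow : ∀ i x, α ‖x‖ ≤ V i x := by
    intro i x
    simpa [flow_zero] using
      exp_mul_flow_le_valueFunction hf hτ₁ hρ.toClassK hbound i ⟨le_rfl, hτ₂⟩ x
  have hVup : ∀ i x, V i x ≤ ρ ‖x‖ := by
    intro i x
    refine valueFunction_le hf hτ₂ fun r _ => (value_le hf hbound r x).trans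
      (mul_le_of_le_one_left (hρ.nonneg (norm_nonneg x)) ?_)
    rw [Real.exp_le_one_iff]
    linarith [r.time_nonneg hτ₁]
  -- The slot j = i is filled by α(|x|), which gives the lower bound even with a single mode.
  set W : Fin M → EuclideanSpace ℝ (Fin n) → ℝ := fun i x =>
    Finset.univ.sup' ⟨i, Finset.mem_univ i⟩ fun j =>
      if j = i then α ‖x‖ else Real.exp τ₁ * V j (flow (hf i) τ₁ x) with hW
  have hWi : ∀ i x, α ‖x‖ ≤ W i x := by
    intro i x
    have := Finset.le_sup' (fun j => if j = i then α ‖x‖ else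
      Real.exp τ₁ * V j (flow (hf i) τ₁ x)) (Finset.mem_univ i)
    simpa only [if_true] using this
  have hWj : ∀ i j x, i ≠ j → Real.exp τ₁ * V j (flow (hf i) τ₁ x) ≤ W i x := by
    intro i j x hij
    have := Finset.le_sup' (fun j => if j = i then α ‖x‖ else
      Real.exp τ₁ * V j (flow (hf i) τ₁ x)) (Finset.mem_univ j)
    simpa only [if_neg hij.symm] using this
  have hWV : ∀ i, ∀ t ∈ Icc 0 (τ₂ - τ₁), ∀ x,
      W i (flow (hf i) t x) ≤ Real.exp (-t) * V i x := by
    intro i t ht x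
    have hexp : ∀ c, Real.exp t * c ≤ V i x → c ≤ Real.exp (-t) * V i x := by
      intro c hc
      calc c = Real.exp (-t) * (Real.exp t * c) := by
            rw [← mul_assoc, ← Real.exp_add, neg_add_cancel, Real.exp_zero, one_mul]
        _ ≤ _ := by gcongr
    refine Finset.sup'_le _ _ fun j _ => hexp _ ?_
    split_ifs with hj
    · exact exp_mul_flow_le_valueFunction hf hτ₁ hρ.toClassK hbound i
        ⟨ht.1, by linarith [ht.2]⟩ x
    -- The combined time t + τ₁ lies in [τ₁, τ₂] exactly because t ∈ [0, τ₂ - τ₁].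
    · rw [flow_add (hf i) hτ₁, ← mul_assoc, ← Real.exp_add]
      exact exp_mul_valueFunction_le hf hτ₁ hτ hρ.toClassK hbound (Ne.symm hj)
        ⟨by linarith [ht.1], by linarith [ht.2]⟩ x
  have hαn : Continuous fun x : EuclideanSpace ℝ (Fin n) => α ‖x‖ :=
    hα.continuousOn.comp_continuous continuous_norm fun x => norm_nonneg x
  refine ⟨α, ρ, V, W, hα, hρ, hVc, fun i => ?_, fun i x => ⟨hVlow i x, hVup i x⟩,
    fun i x => ⟨hWi i x, ?_⟩, hWV, fun i j hij x => ?_⟩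
  · refine Continuous.finset_sup'_apply _ fun j _ => ?_
    split_ifs
    · exact hαn
    · exact continuous_const.mul ((hVc j).comp (continuous_flow (hf i) hτ₁))
  · have := hWV i 0 ⟨le_rfl, by linarith⟩ x
    rw [flow_zero, neg_zero, Real.exp_zero, one_mul] at this
    exact this.trans (hVup i x)
  · have := hWj i j x hij
    calc V j (flow (hf i) τ₁ x) = Real.exp (-τ₁) * (Real.exp τ₁ * V j (flow (hf i) τ₁ x)) := by
          rw [← mul_assoc, ← Real.exp_add, neg_add_cancel, Real.exp_zero, one_mul]
      _ ≤ _ := by gcongr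

end ValueFunction

end SwitchedSystem

theorem theorem1 {n M : ℕ}
    (f : Fin M → EuclideanSpace ℝ (Fin n) → EuclideanSpace ℝ (Fin n))
    (hf : ∀ i, SwitchedSystem.IsRegular (f i))
    (τ₁ τ₂ : ℝ) (hτ₁ : 0 ≤ τ₁) (hτ : τ₁ ≤ τ₂) :
    (SwitchedSystem.GUAS f (SwitchedSystem.dwellSignals M τ₁ τ₂) ↔
      SwitchedSystem.HasLyapunovFunctions hf τ₁ τ₂) ∧
    (SwitchedSystem.GUAS f (SwitchedSystem.dwellSignalsStar M τ₁ τ₂) ↔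
      SwitchedSystem.HasLyapunovFunctions hf τ₁ τ₂) := by
  have hac := SwitchedSystem.hasLyapunovFunctions_of_guas hf hτ₁ hτ
  have hcb := SwitchedSystem.guas_star_of_hasLyapunovFunctions hf (τ₂ := τ₂) hτ₁
  have hba := SwitchedSystem.GUAS.mono (f := f)
    (SwitchedSystem.dwellSignals_subset_star (M := M) (τ₁ := τ₁) (τ₂ := τ₂))
  exact ⟨⟨hac, fun h => hba (hcb h)⟩, ⟨fun h => hac (hba h), hcb⟩⟩
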